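/- Let $\mathbb{F}$ be an arbitrary field and let $V$ be a finite set. A simplicial complex on $V$ is a collection of subsets of $V$ (its faces) that is closed under inclusion; the dimension of a face $F$ is $\dim F=|F|-1$ (so $\dim\emptyset=-1$), and $\dim\Delta$ is the maximal dimension of a face of $\Delta$. For a simplicial complex $\Delta$ on $V$ let $S=\mathbb{F}[x_v : v\in V]$ be the polynomial ring with its standard grading, let $I_\Delta=\big(\prod_{v\in F}x_v : F\subseteq V,\ F\notin\Delta\big)$, let $\mathbb{F}[\Delta]=S/I_\Delta$ be the Stanley–Reisner ring of $\Delta$, and let $$\beta_{i,k}(\mathbb{F}[\Delta])=\dim_{\mathbb{F}}\operatorname{Tor}_i^S(\mathbb{F}[\Delta],\mathbb{F})_{k}$$ be its graded Betti numbers, where $\mathbb{F}=S/(x_v : v\in V)$. For an integer $m$ let $\operatorname{Skel}_{m}(\Delta)=\{F\in\Delta : \dim F\le m\}$. **Theorem.** Let $d\ge 0$ and let $\Delta$ be a $(d-1)$-dimensional simplicial complex on $V$ that is balanced with respect to a partition $V=V_1\,\dot\cup\,\cdots\,\dot\cup\,V_d$, i.e. $|F\cap V_i|\le 1$ for every face $F\in\Delta$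 and every $1\le i\le d$. Put $n_i=|V_i|$, let $K_{n_1,\dots,n_d}$ be the complete $d$-partite graph on $V$ with parts $V_1,\dots,V_d$, and let $\Delta(K_{n_1,\dots,n_d})$ be its clique complex, whose faces are the cliques $F\subseteq V$ of the graph. Then $$\beta_{i,i+j}\big(\mathbb{F}[\Delta]\big)\le\beta_{i,i+j}\big(\mathbb{F}[\operatorname{Skel}_{j-1}(\Delta(K_{n_1,\dots,n_d}))]\big)\qquad\text{for all integers } i,j\ge 0 .$$ -/

import Mathlib

open scoped TensorProduct

universe u v w

/-! ### Simplicial complexes -/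

/-- An (abstract) simplicial complex on the vertex set `V`: a collection of finite subsets of `V`
closed under inclusion. The empty set is a face of every complex that has a face. -/
abbrev SComplex (V : Type v) : Type v := LowerSet (Finset V)

namespace SComplex

/-- `dim F = |F| - 1`; in particular `dim ∅ = -1`. -/
def faceDim {V : Type v} (A : Finset V) : ℤ := (A.card : ℤ) - 1

/-- `Δ` has dimension `e`: the maximum of the dimensions of the faces of `Δ` exists and is `e`. -/
def HasDim {V : Type v} (Δ : SComplex V) (e : ℤ) : Prop :=
  IsGreatest (faceDim '' (Δ : Set (Finset V))) e

/-- The `m`-skeleton: all faces of dimension at most `m`. -/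
def skel {V : Type v} (m : ℤ) (Δ : SComplex V) : SComplex V where
  carrier := {A | A ∈ Δ ∧ faceDim A ≤ m}
  lower' := by
    intro A B hBA hA
    refine ⟨Δ.lower hBA hA.1, le_trans ?_ hA.2⟩
    have := Finset.card_le_card hBA
    unfold faceDim
    omega

/-- The clique complex of a graph: the faces are the cliques. -/
def cliqueComplex {V : Type v} (G : SimpleGraph V) : SComplex V where
  carrier := {A | G.IsClique (A : Set V)}
  lower' := fun _ _ hBA hA => Set.Pairwise.mono (Finset.coe_subset.mpr hBA) hA

/-- A `(d - 1)`-dimensional complex `Δ` on `V` is balanced with respect to the partition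
`V = V_1 ∪ ... ∪ V_d` into the colour classes `V_i = c ⁻¹ {i}` if every face contains at most one
element of every colour class. -/
structure IsBalanced {V : Type v} [DecidableEq V] (Δ : SComplex V) {d : ℕ} (c : V → Fin d) :
    Prop where
  hasDim : Δ.HasDim ((d : ℤ) - 1)
  card_le_one : ∀ A ∈ Δ, ∀ i : Fin d, (A.filter (fun v => c v = i)).card ≤ 1

end SComplex

/-- The complete `d`-partite graph on `V` whose parts are the colour classes `c ⁻¹ {i}`:
two vertices are adjacent exactly if they lie in different classes. -/
def completePartiteGraph {V : Type v} {d : ℕ} (c : V → Fin d) : SimpleGraph V :=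
  SimpleGraph.comap c ⊤

/-! ### Graded Tor over a graded algebra -/

section Subquotient

variable {F R M : Type*} [Field F] [CommRing R] [Algebra F R] [AddCommGroup M] [Module R M]
  [Module F M] [IsScalarTower F R M]

/-- The homology `Z ⧸ (Z ∩ W)` with cycles `Z` and boundaries `W`. -/
abbrev Subquotient (Z W : Submodule R M) := Z ⧸ W.submoduleOf Z

/-- The homology classes in `Z ⧸ (Z ∩ W)` of the cycles that lie in the `F`-subspace `D`. -/
def subquotientPart (D : Submodule F M) (Z W : Submodule R M) : Submodule F (Subquotient Z W) :=
  (D.comap (Z.subtype.restrictScalars F)).map ((W.submoduleOf Z).mkQ.restrictScalars F)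

end Subquotient

section GradedTor

variable {F : Type u} {R : Type w} [Field F] [CommRing R] [Algebra F R]

/-- The degree `k` part of the graded free module `⨁ b, R(-deg b)` over the graded `F`-algebra
`R = ⨁ j, 𝒜 j`, with basis `B` whose element `b` has degree `deg b`. -/
def freeDegree (𝒜 : ℕ → Submodule F R) {B : Type*} (deg : B → ℕ) (k : ℕ) :
    Submodule F (B →₀ R) where
  carrier := {x | ∀ b, (deg b ≤ k → x b ∈ 𝒜 (k - deg b)) ∧ (k < deg b → x b = 0)}
  zero_mem' := fun _ => ⟨fun _ => Submodule.zero_mem _, fun _ => rfl⟩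
  add_mem' := fun hx hy b => ⟨fun h => Submodule.add_mem _ ((hx b).1 h) ((hy b).1 h),
    fun h => by rw [Finsupp.add_apply, (hx b).2 h, (hy b).2 h, add_zero]⟩
  smul_mem' := fun a _ hx b => ⟨fun h => Submodule.smul_mem _ a ((hx b).1 h),
    fun h => by rw [Finsupp.smul_apply, (hx b).2 h, smul_zero]⟩

/-- A graded free resolution `⋯ → P 2 → P 1 → P 0 → R ⧸ J → 0` of the graded `R`-module `R ⧸ J`,
where `P i` is the graded free module on the basis `B i` and all the maps are homogeneous of
degree zero. -/
structure GradedFreeResolution (𝒜 : ℕ → Submodule F R) (J : Ideal R) where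
  B : ℕ → Type w
  deg : ∀ i, B i → ℕ
  d : ∀ i, (B (i + 1) →₀ R) →ₗ[R] (B i →₀ R)
  ε : (B 0 →₀ R) →ₗ[R] (R ⧸ J)
  d_homogeneous : ∀ i k, ∀ x ∈ freeDegree 𝒜 (deg (i + 1)) k, d i x ∈ freeDegree 𝒜 (deg i) k
  ε_homogeneous : ∀ k, ∀ x ∈ freeDegree 𝒜 (deg 0) k, ∃ r ∈ 𝒜 k, ε x = Ideal.Quotient.mk J r
  ε_surjective : Function.Surjective ε
  exact_zero : Function.Exact (d 0) ε
  exact_succ : ∀ i, Function.Exact (d (i + 1)) (d i)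

namespace GradedFreeResolution

variable {𝒜 : ℕ → Submodule F R} {J : Ideal R}

/-- The term `(R ⧸ I) ⊗ P i` of the complex `(R ⧸ I) ⊗ P`. -/
abbrev TensorTerm (P : GradedFreeResolution 𝒜 J) (I : Ideal R) (i : ℕ) : Type w :=
  (R ⧸ I) ⊗[R] (P.B i →₀ R)

/-- The differential `(R ⧸ I) ⊗ P (i + 1) → (R ⧸ I) ⊗ P i`. -/
noncomputable def tensorD (P : GradedFreeResolution 𝒜 J) (I : Ideal R) (i : ℕ) :
    P.TensorTerm I (i + 1) →ₗ[R] P.TensorTerm I i :=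
  LinearMap.lTensor (R ⧸ I) (P.d i)

/-- The degree `k` part of `(R ⧸ I) ⊗ P i`, spanned by the `r ⊗ x` with `r` and `x` homogeneous
and `deg r + deg x = k`. -/
noncomputable def tensorDegree (P : GradedFreeResolution 𝒜 J) (I : Ideal R) (i k : ℕ) :
    Submodule F (P.TensorTerm I i) :=
  Submodule.span F {z | ∃ a b : ℕ, a + b = k ∧ ∃ r ∈ 𝒜 a, ∃ x ∈ freeDegree 𝒜 (P.deg i) b,
    z = Ideal.Quotient.mk I r ⊗ₜ[R] x}

/-- The cycles in homological degree `i`. -/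
noncomputable def cycles (P : GradedFreeResolution 𝒜 J) (I : Ideal R) :
    (i : ℕ) → Submodule R (P.TensorTerm I i)
  | 0 => ⊤
  | i + 1 => LinearMap.ker (P.tensorD I i)

/-- The boundaries in homological degree `i`. -/
noncomputable def boundaries (P : GradedFreeResolution 𝒜 J) (I : Ideal R) (i : ℕ) :
    Submodule R (P.TensorTerm I i) :=
  LinearMap.range (P.tensorD I i)

/-- The dimension over `F` of the degree `k` part `Tor_i^R(R ⧸ I, R ⧸ J)_k` of
`Tor_i^R(R ⧸ I, R ⧸ J)`, the homology of `(R ⧸ I) ⊗ P` in homological degree `i`; the degree `k`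
part consists of the classes of the cycles of degree `k`. -/
noncomputable def torDim (P : GradedFreeResolution 𝒜 J) (I : Ideal R) (i k : ℕ) : ℕ :=
  Module.finrank F (subquotientPart (P.tensorDegree I i k) (P.cycles I i) (P.boundaries I i))

end GradedFreeResolution

/-! ### Every homogeneous quotient has a graded free resolution -/

theorem exists_freeDegree_sum (𝒜 : ℕ → Submodule F R) [GradedAlgebra 𝒜] {B : Type*}
    (deg : B → ℕ) (x : B →₀ R) :
    ∃ (s : Finset ℕ) (y : ℕ → B →₀ R),
      (∀ k, y k ∈ freeDegree 𝒜 deg k) ∧ x = ∑ k ∈ s, y k := by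
  classical
  induction x using Finsupp.induction_linear with
  | zero => exact ⟨∅, 0, fun k => Submodule.zero_mem _, by simp⟩
  | single b q =>
    refine ⟨(DirectSum.decompose 𝒜 q).support.image (· + deg b), fun k => if deg b ≤ k then
        Finsupp.single b (DirectSum.decompose 𝒜 q (k - deg b) : R) else 0, ?_, ?_⟩
    · intro k
      dsimp only
      split_ifs with hk
      · intro b'
        by_cases hb : b = b'
        · subst hb
          rw [Finsupp.single_eq_same]
          exact ⟨fun _ => SetLike.coe_mem _, fun h => absurd hk (not_le.mpr h)⟩
        · rw [Finsupp.single_apply, if_neg hb]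
          exact ⟨fun _ => Submodule.zero_mem _, fun _ => rfl⟩
      · exact Submodule.zero_mem _
    · rw [Finset.sum_image (by intro a _ b _ h; simpa using h)]
      simp only [le_add_iff_nonneg_left, zero_le, if_true]
      have hc : ∀ j : ℕ, (DirectSum.decompose 𝒜 q (j + deg b - deg b) : R) =
          DirectSum.decompose 𝒜 q j := fun j => by rw [Nat.add_sub_cancel]
      rw [Finset.sum_congr rfl fun j _ => congrArg (Finsupp.single b) (hc j)]
      rw [← Finsupp.single_finsetSum, DirectSum.sum_support_decompose]
  | add x z hx hz =>
    obtain ⟨s, y, hy, rfl⟩ := hx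
    obtain ⟨t, y', hy', rfl⟩ := hz
    refine ⟨s ∪ t, fun k => (if k ∈ s then y k else 0) + (if k ∈ t then y' k else 0),
      fun k => Submodule.add_mem _ ?_ ?_, ?_⟩
    · split_ifs; exacts [hy k, Submodule.zero_mem _]
    · split_ifs; exacts [hy' k, Submodule.zero_mem _]
    · rw [Finset.sum_add_distrib, Finset.sum_ite_mem, Finset.sum_ite_mem,
        Finset.union_inter_cancel_left, Finset.union_inter_cancel_right]

theorem freeDegree_eq_zero_of_sum (𝒜 : ℕ → Submodule F R) [GradedAlgebra 𝒜] {B : Type*}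
    (deg : B → ℕ) (s : Finset ℕ) (z : ℕ → B →₀ R) (hz : ∀ k, z k ∈ freeDegree 𝒜 deg k)
    (h : ∑ k ∈ s, z k = 0) : ∀ k ∈ s, z k = 0 := by
  classical
  intro k hk
  ext b
  rw [Finsupp.zero_apply]
  rcases lt_or_ge k (deg b) with hlt | hle
  · exact (hz k b).2 hlt
  · have h0 : ((DirectSum.decompose 𝒜 ((∑ l ∈ s, z l) b)) (k - deg b) : R) = 0 := by simp [h]
    rw [Finsupp.finsetSum_apply, DirectSum.decompose_sum, DFinsupp.finsetSum_apply,
      AddSubmonoidClass.coe_finsetSum, Finset.sum_eq_single k] at h0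
    · rwa [DirectSum.decompose_of_mem_same 𝒜 ((hz k b).1 hle)] at h0
    · intro l _ hl
      rcases lt_or_ge l (deg b) with hlt' | hle'
      · rw [(hz l b).2 hlt']; simp
      · exact DirectSum.decompose_of_mem_ne 𝒜 ((hz l b).1 hle') (by omega)
    · exact fun h => absurd hk h

theorem linearCombination_mem_freeDegree (𝒜 : ℕ → Submodule F R) [GradedAlgebra 𝒜] {B B' : Type*}
    (deg : B → ℕ) (deg' : B' → ℕ) (g : B' → (B →₀ R))
    (hg : ∀ b, g b ∈ freeDegree 𝒜 deg (deg' b)) (k : ℕ)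
    (x : B' →₀ R) (hx : x ∈ freeDegree 𝒜 deg' k) :
    Finsupp.linearCombination R g x ∈ freeDegree 𝒜 deg k := by
  rw [Finsupp.linearCombination_apply]
  refine Submodule.sum_mem _ fun b' _ b => ?_
  rw [Finsupp.smul_apply, smul_eq_mul]
  rcases lt_or_ge k (deg' b') with h1 | h1
  · rw [(hx b').2 h1, zero_mul]
    exact ⟨fun _ => Submodule.zero_mem _, fun _ => rfl⟩
  · rcases lt_or_ge (deg' b') (deg b) with h2 | h2
    · rw [(hg b' b).2 h2, mul_zero]
      exact ⟨fun _ => Submodule.zero_mem _, fun _ => rfl⟩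
    · refine ⟨fun _ => ?_, fun h => by omega⟩
      have := SetLike.mul_mem_graded ((hx b').1 h1) ((hg b' b).1 h2)
      rwa [show k - deg' b' + (deg' b' - deg b) = k - deg b by omega] at this

theorem exact_cover (𝒜 : ℕ → Submodule F R) [GradedAlgebra 𝒜] {B B' : Type*}
    (deg : B → ℕ) (deg' : B' → ℕ) (f : (B' →₀ R) →ₗ[R] (B →₀ R))
    (hf : ∀ k, ∀ x ∈ freeDegree 𝒜 deg' k, f x ∈ freeDegree 𝒜 deg k) :
    Function.Exact (Finsupp.linearCombination R
      fun p : {p : ℕ × (B' →₀ R) // p.2 ∈ freeDegree 𝒜 deg' p.1 ∧ f p.2 = 0} => p.1.2) f := by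
  intro x
  constructor
  · intro hx
    obtain ⟨t, y, hy, rfl⟩ := exists_freeDegree_sum 𝒜 deg' x
    rw [map_sum] at hx
    have h0 := freeDegree_eq_zero_of_sum 𝒜 deg t (fun k => f (y k)) (fun k => hf k _ (hy k)) hx
    rw [← LinearMap.coe_range]
    refine Submodule.sum_mem _ fun k hk => ?_
    refine ⟨Finsupp.single ⟨(k, y k), hy k, h0 k hk⟩ 1, ?_⟩
    rw [Finsupp.linearCombination_single, one_smul]
  · rintro ⟨z, rfl⟩
    rw [Finsupp.linearCombination_apply, Finsupp.sum, map_sum]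
    refine Finset.sum_eq_zero fun p _ => ?_
    rw [map_smul, p.2.2, smul_zero]

theorem exact_idealCover (𝒜 : ℕ → Submodule F R) [GradedAlgebra 𝒜] (J : Ideal R)
    (hJ : J.IsHomogeneous 𝒜) :
    Function.Exact (Finsupp.linearCombination R
        fun p : {p : ℕ × R // p.2 ∈ 𝒜 p.1 ∧ p.2 ∈ J} => Finsupp.single PUnit.unit.{w + 1} p.1.2)
      (J.mkQ.comp (Finsupp.lapply PUnit.unit.{w + 1})) := by
  classical
  intro x
  rw [LinearMap.comp_apply, Submodule.mkQ_apply, Submodule.Quotient.mk_eq_zero,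
    Finsupp.lapply_apply]
  constructor
  · intro h
    have hx : x = ∑ k ∈ (DirectSum.decompose 𝒜 (x PUnit.unit)).support,
        Finsupp.single PUnit.unit (DirectSum.decompose 𝒜 (x PUnit.unit) k : R) := by
      rw [← Finsupp.single_finsetSum, DirectSum.sum_support_decompose]
      ext
      rw [Finsupp.single_eq_same]
    rw [← LinearMap.coe_range, hx]
    refine Submodule.sum_mem _ fun k _ => ?_
    refine ⟨Finsupp.single ⟨(k, _), SetLike.coe_mem _, hJ k h⟩ 1, ?_⟩
    rw [Finsupp.linearCombination_single, one_smul]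
  · rintro ⟨z, rfl⟩
    rw [Finsupp.linearCombination_apply, Finsupp.sum, Finsupp.finsetSum_apply]
    refine Submodule.sum_mem _ fun p _ => ?_
    rw [Finsupp.smul_apply, Finsupp.single_eq_same, smul_eq_mul]
    exact J.mul_mem_left _ p.2.2

/-- A homogeneous map of degree zero between graded free modules. -/
structure FreeGradedMap (𝒜 : ℕ → Submodule F R) where
  B : Type w
  B' : Type w
  deg : B → ℕ
  deg' : B' → ℕ
  f : (B' →₀ R) →ₗ[R] (B →₀ R)
  hom : ∀ k, ∀ x ∈ freeDegree 𝒜 deg' k, f x ∈ freeDegree 𝒜 deg k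

/-- The cover of the kernel of a homogeneous map by the graded free module on all the homogeneous
elements of the kernel. -/
noncomputable def FreeGradedMap.next {𝒜 : ℕ → Submodule F R} [GradedAlgebra 𝒜]
    (s : FreeGradedMap 𝒜) : FreeGradedMap 𝒜 where
  B := s.B'
  B' := {p : ℕ × (s.B' →₀ R) // p.2 ∈ freeDegree 𝒜 s.deg' p.1 ∧ s.f p.2 = 0}
  deg := s.deg'
  deg' := fun p => p.1.1
  f := Finsupp.linearCombination R fun p => p.1.2
  hom := linearCombination_mem_freeDegree 𝒜 _ _ _ fun p => p.2.1

theorem FreeGradedMap.next_exact {𝒜 : ℕ → Submodule F R} [GradedAlgebra 𝒜]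
    (s : FreeGradedMap 𝒜) : Function.Exact s.next.f s.f :=
  exact_cover 𝒜 s.deg s.deg' s.f s.hom

/-- The cover of `J ⊆ R` by the graded free module on all the homogeneous elements of `J`, as a map
to `R`, the graded free module on one basis element of degree `0`. -/
noncomputable def FreeGradedMap.ofIdeal (𝒜 : ℕ → Submodule F R) [GradedAlgebra 𝒜] (J : Ideal R) :
    FreeGradedMap 𝒜 where
  B := PUnit
  B' := {p : ℕ × R // p.2 ∈ 𝒜 p.1 ∧ p.2 ∈ J}
  deg := fun _ => 0
  deg' := fun p => p.1.1
  f := Finsupp.linearCombination R fun p => Finsupp.single PUnit.unit p.1.2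
  hom := linearCombination_mem_freeDegree 𝒜 _ _ _ fun p b =>
    ⟨fun _ => by rw [Finsupp.single_eq_same]; exact p.2.1, fun h => absurd h (Nat.not_lt_zero _)⟩

/-- The maps of the standard resolution. -/
noncomputable def FreeGradedMap.iterate (𝒜 : ℕ → Submodule F R) [GradedAlgebra 𝒜] (J : Ideal R) :
    ℕ → FreeGradedMap 𝒜
  | 0 => FreeGradedMap.ofIdeal 𝒜 J
  | i + 1 => (FreeGradedMap.iterate 𝒜 J i).next

/-- The standard graded free resolution of `R ⧸ J`, for a homogeneous ideal `J`: in each step the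
kernel is covered by the graded free module on all its homogeneous elements. -/
noncomputable def standardResolution (𝒜 : ℕ → Submodule F R) [GradedAlgebra 𝒜] (J : Ideal R)
    (hJ : J.IsHomogeneous 𝒜) : GradedFreeResolution 𝒜 J where
  B := fun i => (FreeGradedMap.iterate 𝒜 J i).B
  deg := fun i => (FreeGradedMap.iterate 𝒜 J i).deg
  d := fun i => (FreeGradedMap.iterate 𝒜 J i).f
  ε := J.mkQ.comp (Finsupp.lapply PUnit.unit)
  d_homogeneous := fun i => (FreeGradedMap.iterate 𝒜 J i).hom
  ε_homogeneous := fun _ x hx => ⟨x PUnit.unit, (hx PUnit.unit).1 (Nat.zero_le _), rfl⟩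
  ε_surjective := fun q => by
    obtain ⟨r, rfl⟩ := Submodule.Quotient.mk_surjective J q
    exact ⟨Finsupp.single PUnit.unit r,
      congrArg (Submodule.Quotient.mk (p := J)) Finsupp.single_eq_same⟩
  exact_zero := exact_idealCover 𝒜 J hJ
  exact_succ := fun i => (FreeGradedMap.iterate 𝒜 J i).next_exact

end GradedTor

/-! ### Graded Betti numbers over the polynomial ring -/

section Betti

attribute [local instance] MvPolynomial.gradedAlgebra

/-- The maximal homogeneous ideal `𝔪 = (x_v : v ∈ V)` of `S = F[x_v : v ∈ V]`. The residue field
`S ⧸ 𝔪` is `F` as a graded `S`-module. -/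
noncomputable def maxHomogeneousIdeal (F : Type u) (V : Type v) [Field F] :
    Ideal (MvPolynomial V F) :=
  Ideal.span (Set.range MvPolynomial.X)

theorem maxHomogeneousIdeal_isHomogeneous (F : Type u) (V : Type v) [Field F] :
    (maxHomogeneousIdeal F V).IsHomogeneous (MvPolynomial.homogeneousSubmodule V F) := by
  refine Ideal.homogeneous_span _ _ ?_
  rintro _ ⟨a, rfl⟩
  exact ⟨1, MvPolynomial.isHomogeneous_X F a⟩

/-- The graded Betti number `β_{i,k}(S ⧸ I) = dim_F Tor_i^S(S ⧸ I, F)_k` of a homogeneous ideal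
`I` of the polynomial ring `S = F[x_v : v ∈ V]` with its standard grading. -/
noncomputable def gradedBetti {F : Type u} {V : Type v} [Field F] (I : Ideal (MvPolynomial V F))
    (i k : ℕ) : ℕ :=
  (standardResolution (MvPolynomial.homogeneousSubmodule V F)
    (maxHomogeneousIdeal F V) (maxHomogeneousIdeal_isHomogeneous F V)).torDim I i k

end Betti

/-- The Stanley-Reisner ideal `I_Δ = (x_A : A ∉ Δ)`, where `x_A = ∏ v ∈ A, x_v`. The
Stanley-Reisner ring is `F[Δ] = S ⧸ I_Δ`. -/
noncomputable def stanleyReisnerIdeal (F : Type u) {V : Type v} [Field F] (Δ : SComplex V) :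
    Ideal (MvPolynomial V F) :=
  Ideal.span {p | ∃ A : Finset V, A ∉ Δ ∧ p = ∏ v ∈ A, MvPolynomial.X v}

/-! ### Comparing ranks of homology spaces -/

/-! Tor may be computed from the Koszul complex `K` on the variables, whose elements are
combinations of `x ^ a • e_A`. So `β_{i,i+j}` of a Stanley–Reisner ring is the dimension of the
homology of `K` modulo the ideal, in the part with `|A| = i` and `deg a = j`. Every cycle modulo the
ideal is homologous to its squarefree part: for each vertex `v` there is a homotopy that divides by
`x_v`, and it preserves the ideal because dividing a monomial of `x_v`-degree at least 2 by `x_v`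
keeps its support.

In squarefree multidegree the support of `a` has exactly `deg a` elements, so only faces of a fixed
size matter: size `j + 1` for the cycle condition and size `j` for equality modulo boundaries. Let
`Δ'` have no face with more than `j` elements and contain every `j`-element face of `Δ`. All
monomials of degree `j + 1` in question lie in the ideal of `Δ'`, so every squarefree chain of this
bidegree is a cycle for `Δ'`. A relation modulo the ideal of `Δ'` is also one modulo the ideal of
`Δ`, since a `j`-element nonface of `Δ'` is a nonface of `Δ`. Hence the homology for `Δ` is a
subquotient of that for `Δ'`. The skeleton of the clique complex is such a `Δ'`, since balanced
faces are cliques of the complete multipartite graph.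

The argument is carried by `Koszul.gradedBetti_eq` (Betti numbers from Koszul homology, via the
comparison theorem for resolutions), `Koszul.diff_homotopy` and `Koszul.trunc_homologous`
(squarefree reduction), and `classRank_stanleyReisner_le` (the comparison). -/

theorem LinearMap.rank_range_le_of_apply_eq_zero {F : Type u} [Field F] {B : Type*} {X Y : Type w}
    [AddCommGroup B] [Module F B] [AddCommGroup X] [Module F X] [AddCommGroup Y] [Module F Y]
    (f : B →ₗ[F] X) (g : B →ₗ[F] Y) (h : ∀ b, g b = 0 → f b = 0) :
    Module.rank F (LinearMap.range f) ≤ Module.rank F (LinearMap.range g) := by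
  have hker : LinearMap.ker g ≤ LinearMap.ker f := fun b hb =>
    LinearMap.mem_ker.mpr (h b (LinearMap.mem_ker.mp hb))
  let e := g.quotKerEquivRange
  let φ : LinearMap.range g →ₗ[F] X := ((LinearMap.ker g).liftQ f hker).comp e.symm.toLinearMap
  have : LinearMap.range φ = LinearMap.range f := by
    rw [LinearMap.range_comp_of_range_eq_top _ (LinearEquiv.range _), Submodule.range_liftQ]
  rw [← this]
  exact rank_range_le φ

/-- The dimension of the space of classes of the elements of `N` modulo `W`. -/
noncomputable def classRank {F : Type u} [Field F] {M : Type w} [AddCommGroup M] [Module F M]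
    (N W : Submodule F M) : Cardinal.{w} :=
  Module.rank F (LinearMap.range (W.mkQ.comp N.subtype))

/-- The classes of `N` lie in the image of `N'` in `M ⧸ W`, and that image is a quotient of the
classes of `N'`. The map `π` need not send `N'` into `N`: in the main comparison, cycles for the
larger side need not map to cycles. -/
theorem classRank_le {F : Type u} [Field F] {M M' : Type w} [AddCommGroup M] [Module F M]
    [AddCommGroup M'] [Module F M'] {N W : Submodule F M} {N' W' : Submodule F M'}
    (π : M' →ₗ[F] M) (h₁ : ∀ x ∈ N, ∃ y ∈ N', x - π y ∈ W)
    (h₂ : ∀ y ∈ N', y ∈ W' → π y ∈ W) : classRank N W ≤ classRank N' W' := by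
  let f : N' →ₗ[F] M ⧸ W := W.mkQ.comp (π.comp N'.subtype)
  have hf : LinearMap.range (W.mkQ.comp N.subtype) ≤ LinearMap.range f := by
    rintro _ ⟨⟨x, hx⟩, rfl⟩
    obtain ⟨y, hy, hxy⟩ := h₁ x hx
    exact ⟨⟨y, hy⟩, ((Submodule.Quotient.eq W).mpr hxy).symm⟩
  refine (Submodule.rank_mono hf).trans (LinearMap.rank_range_le_of_apply_eq_zero f _ ?_)
  rintro ⟨y, hy⟩ hy'
  exact (Submodule.Quotient.mk_eq_zero W).mpr
    (h₂ y hy ((Submodule.Quotient.mk_eq_zero W').mp hy'))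

/-- Needed to pass from cardinals to natural numbers, since `Cardinal.toNat` sends infinite
cardinals to 0. -/
theorem classRank_lt_aleph0 {F : Type u} [Field F] {M : Type w} [AddCommGroup M] [Module F M]
    (N W : Submodule F M) [Module.Finite F N] : classRank N W < Cardinal.aleph0 :=
  Module.rank_lt_aleph0 F _

/-! ### Homogeneous maps between graded free modules -/

section Lifting

variable {F : Type u} {R : Type w} [Field F] [CommRing R] [Algebra F R]

theorem single_mem_freeDegree (𝒜 : ℕ → Submodule F R) {B : Type*} (deg : B → ℕ) (b : B)
    {k : ℕ} {r : R} (hr : r ∈ 𝒜 k) :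
    Finsupp.single b r ∈ freeDegree 𝒜 deg (k + deg b) := by
  classical
  intro b'
  rw [Finsupp.single_apply]
  split_ifs with h
  · subst h
    exact ⟨fun _ => by rwa [Nat.add_sub_cancel], fun h => absurd h (by omega)⟩
  · exact ⟨fun _ => Submodule.zero_mem _, fun _ => rfl⟩

variable {𝒜 : ℕ → Submodule F R} [GradedAlgebra 𝒜]

theorem single_one_mem_freeDegree {B : Type*} (deg : B → ℕ) (b : B) :
    Finsupp.single b (1 : R) ∈ freeDegree 𝒜 deg (deg b) := by
  simpa using single_mem_freeDegree 𝒜 deg b (SetLike.one_mem_graded 𝒜)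

theorem exists_homogeneous_preimage {B B' : Type*} {deg : B → ℕ} {deg' : B' → ℕ}
    {f : (B' →₀ R) →ₗ[R] (B →₀ R)}
    (hf : ∀ k, ∀ x ∈ freeDegree 𝒜 deg' k, f x ∈ freeDegree 𝒜 deg k) {k : ℕ} {x : B →₀ R}
    (hx : x ∈ freeDegree 𝒜 deg k) (hxf : x ∈ LinearMap.range f) :
    ∃ y ∈ freeDegree 𝒜 deg' k, f y = x := by
  classical
  obtain ⟨z, rfl⟩ := hxf
  obtain ⟨s, y, hy, hz⟩ := exists_freeDegree_sum 𝒜 deg' z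
  -- The images of the components of `z`, minus `f z` placed in degree `k`, sum to zero, so each
  -- degree vanishes separately. The index `k` may be missing from `s`, hence `insert` and the
  -- default value 0.
  have key := freeDegree_eq_zero_of_sum 𝒜 deg (insert k s)
    (fun l => (if l ∈ s then f (y l) else 0) - if l = k then f z else 0)
    (fun l => by
      refine Submodule.sub_mem _ ?_ ?_
      · split_ifs; exacts [hf l _ (hy l), Submodule.zero_mem _]
      · split_ifs with h; exacts [h ▸ hx, Submodule.zero_mem _])
    (by
      rw [Finset.sum_sub_distrib, Finset.sum_ite_mem, Finset.sum_ite_eq',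
        if_pos (Finset.mem_insert_self k s),
        Finset.inter_eq_right.mpr (Finset.subset_insert k s), ← map_sum, ← hz, sub_self])
    k (Finset.mem_insert_self k s)
  rw [if_pos rfl, sub_eq_zero] at key
  refine ⟨if k ∈ s then y k else 0, ?_, ?_⟩
  · split_ifs; exacts [hy k, Submodule.zero_mem _]
  · rw [← key, apply_ite f, map_zero]

theorem exists_homogeneous_lift {B B' B'' : Type*} {deg : B → ℕ} {deg' : B' → ℕ}
    {deg'' : B'' → ℕ} {f : (B' →₀ R) →ₗ[R] (B →₀ R)}
    (hf : ∀ k, ∀ x ∈ freeDegree 𝒜 deg' k, f x ∈ freeDegree 𝒜 deg k)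
    {g : (B'' →₀ R) →ₗ[R] (B →₀ R)}
    (hg : ∀ k, ∀ x ∈ freeDegree 𝒜 deg'' k, g x ∈ freeDegree 𝒜 deg k)
    (hgf : ∀ x, g x ∈ LinearMap.range f) :
    ∃ l : (B'' →₀ R) →ₗ[R] (B' →₀ R),
      (∀ k, ∀ x ∈ freeDegree 𝒜 deg'' k, l x ∈ freeDegree 𝒜 deg' k) ∧ ∀ x, f (l x) = g x := by
  choose y hy hfy using fun b : B'' => exists_homogeneous_preimage hf
    (hg _ _ (single_one_mem_freeDegree deg'' b)) (hgf _)
  refine ⟨Finsupp.linearCombination R y, linearCombination_mem_freeDegree 𝒜 _ _ y hy, fun x => ?_⟩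
  refine LinearMap.congr_fun (f := f.comp (Finsupp.linearCombination R y)) ?_ x
  ext1 b
  ext1
  simp [hfy]

end Lifting

namespace GradedFreeResolution

variable {F : Type u} {R : Type w} [Field F] [CommRing R] [Algebra F R]
variable {𝒜 : ℕ → Submodule F R} {J : Ideal R}

/-! ### The comparison theorem -/

/-- This serves to build homotopies. They need no grading, because boundaries are taken without a
degree condition. -/
theorem exists_lift {P : GradedFreeResolution 𝒜 J} {i : ℕ} {B : Type*}
    (g : (B →₀ R) →ₗ[R] (P.B i →₀ R)) (hg : ∀ x, g x ∈ LinearMap.range (P.d i)) :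
    ∃ h : (B →₀ R) →ₗ[R] (P.B (i + 1) →₀ R), ∀ x, P.d i (h x) = g x := by
  choose y hy using fun b : B => hg (Finsupp.single b 1)
  refine ⟨Finsupp.linearCombination R y, fun x => ?_⟩
  refine LinearMap.congr_fun (f := (P.d i).comp (Finsupp.linearCombination R y)) ?_ x
  ext1 b
  ext1
  simp [hy]

/-- The target `R ⧸ J` of the augmentations is not free, so the homogeneous preimage of a basis
element is found by comparing components modulo `J`, which is where homogeneity of `J` enters. -/
theorem exists_lift_zero [GradedAlgebra 𝒜] (hJ : J.IsHomogeneous 𝒜)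
    (P Q : GradedFreeResolution 𝒜 J) :
    ∃ f : (P.B 0 →₀ R) →ₗ[R] (Q.B 0 →₀ R),
      (∀ k, ∀ x ∈ freeDegree 𝒜 (P.deg 0) k, f x ∈ freeDegree 𝒜 (Q.deg 0) k) ∧
        ∀ x, Q.ε (f x) = P.ε x := by
  classical
  have key : ∀ b : P.B 0, ∃ y ∈ freeDegree 𝒜 (Q.deg 0) (P.deg 0 b),
      Q.ε y = P.ε (Finsupp.single b 1) := by
    intro b
    obtain ⟨r, hr, hrb⟩ := P.ε_homogeneous _ _ (single_one_mem_freeDegree (P.deg 0) b)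
    obtain ⟨z, hz⟩ := Q.ε_surjective (P.ε (Finsupp.single b 1))
    obtain ⟨s, y, hy, rfl⟩ := exists_freeDegree_sum 𝒜 (Q.deg 0) z
    choose t ht htε using fun k => Q.ε_homogeneous k _ (hy k)
    have hmem : ∑ k ∈ s, t k - r ∈ J := by
      rw [← Ideal.Quotient.eq, map_sum, ← hrb, ← hz, map_sum]
      exact Finset.sum_congr rfl fun k _ => (htε k).symm
    have hcomp := hJ (P.deg 0 b) hmem
    rw [DirectSum.decompose_sub, DirectSum.decompose_sum, DirectSum.sub_apply,
      DFinsupp.finsetSum_apply, AddSubgroupClass.coe_sub, AddSubmonoidClass.coe_finsetSum,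
      DirectSum.decompose_of_mem_same 𝒜 hr] at hcomp
    -- If the degree does not occur in `s`, the component of the difference is `-r`, so `r ∈ J` and
    -- 0 is a valid preimage.
    refine ⟨if P.deg 0 b ∈ s then y (P.deg 0 b) else 0, ?_, ?_⟩
    · split_ifs; exacts [hy _, Submodule.zero_mem _]
    · rw [hrb, apply_ite Q.ε, map_zero, htε]
      rw [← Ideal.Quotient.eq] at hcomp
      rw [← hcomp]
      split_ifs with hs
      · rw [Finset.sum_eq_single_of_mem _ hs fun k _ hk =>
          DirectSum.decompose_of_mem_ne 𝒜 (ht k) hk, DirectSum.decompose_of_mem_same 𝒜 (ht _)]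
      · rw [Finset.sum_eq_zero fun k hk => DirectSum.decompose_of_mem_ne 𝒜 (ht k)
          (by rintro rfl; exact hs hk), map_zero]
  choose y hy hyε using key
  refine ⟨Finsupp.linearCombination R y, linearCombination_mem_freeDegree 𝒜 _ _ y hy, fun x => ?_⟩
  refine LinearMap.congr_fun (f := Q.ε.comp (Finsupp.linearCombination R y)) ?_ x
  ext1 b
  ext1
  simp [hyε]

/-- A homogeneous chain map between two graded free resolutions over the identity of `R ⧸ J`. -/
structure Hom (P Q : GradedFreeResolution 𝒜 J) where
  f : ∀ i, (P.B i →₀ R) →ₗ[R] (Q.B i →₀ R)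
  hom : ∀ i k, ∀ x ∈ freeDegree 𝒜 (P.deg i) k, f i x ∈ freeDegree 𝒜 (Q.deg i) k
  comm : ∀ i x, Q.d i (f (i + 1) x) = f i (P.d i x)
  ε_comm : ∀ x, Q.ε (f 0 x) = P.ε x

theorem nonempty_hom [GradedAlgebra 𝒜] (hJ : J.IsHomogeneous 𝒜) (P Q : GradedFreeResolution 𝒜 J) :
    Nonempty (Hom P Q) := by
  -- Each stage carries the invariant that `f ∘ d` lands in the range of the next differential,
  -- which is what the following lift requires.
  let St : ℕ → Type w := fun i => {f : (P.B i →₀ R) →ₗ[R] (Q.B i →₀ R) //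
    (∀ k, ∀ x ∈ freeDegree 𝒜 (P.deg i) k, f x ∈ freeDegree 𝒜 (Q.deg i) k) ∧
      ∀ x, f (P.d i x) ∈ LinearMap.range (Q.d i)}
  obtain ⟨f₀, h₀, hε⟩ := exists_lift_zero hJ P Q
  have step : ∀ i (s : St i), ∃ s' : St (i + 1), ∀ x, Q.d i (s'.1 x) = s.1 (P.d i x) := by
    rintro i ⟨s, hs, hsd⟩
    obtain ⟨l, hl, hls⟩ := exists_homogeneous_lift (Q.d_homogeneous i)
      (g := s.comp (P.d i)) (deg'' := P.deg (i + 1))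
      (fun k x hx => hs k _ (P.d_homogeneous i k x hx)) hsd
    refine ⟨⟨l, hl, fun x => (Q.exact_succ i _).mp ?_⟩, hls⟩
    rw [hls, LinearMap.comp_apply, (P.exact_succ i _).mpr ⟨x, rfl⟩, map_zero]
  choose next hnext using step
  let s₀ : St 0 := ⟨f₀, h₀, fun x => (Q.exact_zero _).mp
    (by rw [hε, (P.exact_zero _).mpr ⟨x, rfl⟩])⟩
  let s : ∀ i, St i := fun i => Nat.rec s₀ next i
  exact ⟨⟨fun i => (s i).1, fun i => (s i).2.1, fun i x => hnext i (s i) x, hε⟩⟩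

theorem exists_homotopy_zero {P Q : GradedFreeResolution 𝒜 J} (f : Hom P Q) (g : Hom Q P) :
    ∃ h : (P.B 0 →₀ R) →ₗ[R] (P.B 1 →₀ R), ∀ x, x - g.f 0 (f.f 0 x) = P.d 0 (h x) := by
  obtain ⟨h, hh⟩ := exists_lift (P := P) (LinearMap.id - (g.f 0).comp (f.f 0))
    fun x => (P.exact_zero _).mp (by simp [g.ε_comm, f.ε_comm])
  exact ⟨h, fun x => (hh x).symm⟩

theorem exists_homotopy_succ [GradedAlgebra 𝒜] {P Q : GradedFreeResolution 𝒜 J}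
    (f : Hom P Q) (g : Hom Q P) (i : ℕ) :
    ∃ (h : (P.B (i + 1) →₀ R) →ₗ[R] (P.B (i + 2) →₀ R))
      (h' : (P.B i →₀ R) →ₗ[R] (P.B (i + 1) →₀ R)),
      ∀ x, x - g.f (i + 1) (f.f (i + 1) x) = P.d (i + 1) (h x) + h' (P.d i x) := by
  induction i with
  | zero =>
    obtain ⟨h', hh'⟩ := exists_homotopy_zero f g
    obtain ⟨h, hh⟩ := exists_lift (P := P)
      (LinearMap.id - (g.f 1).comp (f.f 1) - h'.comp (P.d 0))
      fun x => (P.exact_succ 0 _).mp (by simp [g.comm, f.comm, ← hh'])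
    exact ⟨h, h', fun x => by simp [hh]⟩
  | succ i ih =>
    -- The upper homotopy of the previous stage becomes the lower one of the next.
    obtain ⟨h', h'', hh'⟩ := ih
    obtain ⟨h, hh⟩ := exists_lift (P := P)
      (LinearMap.id - (g.f (i + 2)).comp (f.f (i + 2)) - h'.comp (P.d (i + 1)))
      fun x => (P.exact_succ (i + 1) _).mp (by
        have h0 : P.d i (P.d (i + 1) x) = 0 := (P.exact_succ i _).mpr ⟨x, rfl⟩
        have := hh' (P.d (i + 1) x)
        rw [h0, map_zero, add_zero] at this
        simp [g.comm, f.comm, ← this])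
    exact ⟨h, h', fun x => by simp [hh]⟩

/-! ### Homology of `(R ⧸ I) ⊗ P` in terms of `P` -/

theorem mk_one_tmul_eq_zero_iff (I : Ideal R) {B : Type*} (x : B →₀ R) :
    (1 : R ⧸ I) ⊗ₜ[R] x = 0 ↔ ∀ b, x b ∈ I := by
  classical
  rw [← (TensorProduct.finsuppScalarRight R R (R ⧸ I) B).map_eq_zero_iff, Finsupp.ext_iff]
  refine forall_congr' fun b => ?_
  rw [TensorProduct.finsuppScalarRight_apply_tmul_apply, Finsupp.zero_apply,
    ← Ideal.Quotient.eq_zero_iff_mem, Algebra.smul_def, mul_one]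
  rfl

theorem mk_tmul (I : Ideal R) {B : Type*} (r : R) (x : B →₀ R) :
    Ideal.Quotient.mk I r ⊗ₜ[R] x = 1 ⊗ₜ[R] (r • x) := by
  rw [TensorProduct.tmul_smul, TensorProduct.smul_tmul', Algebra.smul_def, mul_one]
  rfl

theorem exists_one_tmul (I : Ideal R) {B : Type*} (z : (R ⧸ I) ⊗[R] (B →₀ R)) :
    ∃ x : B →₀ R, z = 1 ⊗ₜ[R] x := by
  induction z with
  | zero => exact ⟨0, (TensorProduct.tmul_zero _ _).symm⟩
  | tmul r x =>
    obtain ⟨r, rfl⟩ := Ideal.Quotient.mk_surjective r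
    exact ⟨r • x, mk_tmul I r x⟩
  | add y z hy hz =>
    obtain ⟨x, rfl⟩ := hy
    obtain ⟨x', rfl⟩ := hz
    exact ⟨x + x', (TensorProduct.tmul_add _ _ _).symm⟩

/-- The cycles of degree `k` of `(R ⧸ I) ⊗ P`, lifted to `P`. -/
noncomputable def cycleLifts (P : GradedFreeResolution 𝒜 J) (I : Ideal R) (i k : ℕ) :
    Submodule F (P.B i →₀ R) :=
  freeDegree 𝒜 (P.deg i) k ⊓
    (((P.cycles I i).comap (TensorProduct.mk R (R ⧸ I) (P.B i →₀ R) 1)).restrictScalars F)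

/-- The boundaries of `(R ⧸ I) ⊗ P`, lifted to `P`. -/
noncomputable def boundaryLifts (P : GradedFreeResolution 𝒜 J) (I : Ideal R) (i : ℕ) :
    Submodule F (P.B i →₀ R) :=
  ((P.boundaries I i).comap (TensorProduct.mk R (R ⧸ I) (P.B i →₀ R) 1)).restrictScalars F

theorem mem_cycleLifts_zero {P : GradedFreeResolution 𝒜 J} {I : Ideal R} {k : ℕ}
    {x : P.B 0 →₀ R} : x ∈ P.cycleLifts I 0 k ↔ x ∈ freeDegree 𝒜 (P.deg 0) k :=
  ⟨fun h => h.1, fun h => ⟨h, Submodule.mem_top⟩⟩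

theorem mem_cycleLifts_succ {P : GradedFreeResolution 𝒜 J} {I : Ideal R} {i k : ℕ}
    {x : P.B (i + 1) →₀ R} : x ∈ P.cycleLifts I (i + 1) k ↔
      x ∈ freeDegree 𝒜 (P.deg (i + 1)) k ∧ ∀ b, P.d i x b ∈ I := by
  rw [← mk_one_tmul_eq_zero_iff]
  rfl

theorem mem_boundaryLifts {P : GradedFreeResolution 𝒜 J} {I : Ideal R} {i : ℕ}
    {x : P.B i →₀ R} : x ∈ P.boundaryLifts I i ↔ ∃ w, ∀ b, (x - P.d i w) b ∈ I := by
  simp_rw [← mk_one_tmul_eq_zero_iff, TensorProduct.tmul_sub, sub_eq_zero]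
  constructor
  · rintro ⟨z, hz⟩
    obtain ⟨w, rfl⟩ := exists_one_tmul I z
    exact ⟨w, hz.symm⟩
  · rintro ⟨w, hw⟩
    exact ⟨1 ⊗ₜ[R] w, hw.symm⟩

theorem mem_tensorDegree [GradedAlgebra 𝒜] {P : GradedFreeResolution 𝒜 J} {I : Ideal R} {i k : ℕ}
    {z : P.TensorTerm I i} : z ∈ P.tensorDegree I i k ↔
      ∃ x ∈ freeDegree 𝒜 (P.deg i) k, 1 ⊗ₜ[R] x = z := by
  constructor
  · intro hz
    have hle : P.tensorDegree I i k ≤ (freeDegree 𝒜 (P.deg i) k).map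
        ((TensorProduct.mk R (R ⧸ I) (P.B i →₀ R) 1).restrictScalars F) := by
      refine Submodule.span_le.mpr ?_
      rintro _ ⟨a, b, rfl, r, hr, x, hx, rfl⟩
      refine ⟨r • x, fun c => ?_, (mk_tmul I r x).symm⟩
      rw [Finsupp.smul_apply, smul_eq_mul]
      rcases lt_or_ge b (P.deg i c) with hb | hb
      · rw [(hx c).2 hb, mul_zero]
        exact ⟨fun _ => Submodule.zero_mem _, fun _ => rfl⟩
      · refine ⟨fun _ => ?_, fun h => by omega⟩
        rw [Nat.add_sub_assoc hb]
        exact SetLike.mul_mem_graded hr ((hx c).1 hb)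
    exact hle hz
  · rintro ⟨x, hx, rfl⟩
    exact Submodule.subset_span ⟨0, k, zero_add k, 1, SetLike.one_mem_graded 𝒜, x, hx, rfl⟩

/-- Every tensor has the form `1 ⊗ x`. The map sending `x` to the class of `1 ⊗ x` is onto the
degree `k` part and has the same kernel as reduction modulo the lifted boundaries, so the two ranges
have equal rank. -/
theorem torDim_eq [GradedAlgebra 𝒜] (P : GradedFreeResolution 𝒜 J) (I : Ideal R) (i k : ℕ) :
    P.torDim I i k = Cardinal.toNat (classRank (P.cycleLifts I i k) (P.boundaryLifts I i)) := by
  let f : P.cycleLifts I i k →ₗ[F] Subquotient (P.cycles I i) (P.boundaries I i) :=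
    { toFun := fun x => Submodule.Quotient.mk ⟨1 ⊗ₜ[R] x.1, x.2.2⟩
      map_add' := fun x y => by
        rw [← Submodule.Quotient.mk_add]
        exact congrArg _ (Subtype.ext (TensorProduct.tmul_add _ _ _))
      map_smul' := fun a x => by
        rw [RingHom.id_apply, ← Submodule.Quotient.mk_smul]
        exact congrArg _ (Subtype.ext (TensorProduct.tmul_smul _ _ _)) }
  have hker : ∀ x, f x = 0 ↔
      ((P.boundaryLifts I i).mkQ.comp (P.cycleLifts I i k).subtype) x = 0 := by
    intro x
    rw [LinearMap.comp_apply, Submodule.mkQ_apply, Submodule.Quotient.mk_eq_zero]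
    exact Submodule.Quotient.mk_eq_zero _
  have hrange : LinearMap.range f = subquotientPart (P.tensorDegree I i k) (P.cycles I i)
      (P.boundaries I i) := by
    ext q
    constructor
    · rintro ⟨x, rfl⟩
      exact ⟨⟨1 ⊗ₜ[R] x.1, x.2.2⟩, mem_tensorDegree.mpr ⟨x.1, x.2.1, rfl⟩, rfl⟩
    · rintro ⟨⟨z, hz⟩, hzD, rfl⟩
      obtain ⟨x, hx, rfl⟩ := mem_tensorDegree.mp hzD
      exact ⟨⟨x, hx, hz⟩, rfl⟩
  rw [torDim, ← hrange, Module.finrank, classRank]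
  have h₁ := LinearMap.rank_range_le_of_apply_eq_zero f
    ((P.boundaryLifts I i).mkQ.comp (P.cycleLifts I i k).subtype) fun x => (hker x).mpr
  have h₂ := LinearMap.rank_range_le_of_apply_eq_zero
    ((P.boundaryLifts I i).mkQ.comp (P.cycleLifts I i k).subtype) f fun x => (hker x).mp
  rw [le_antisymm h₁ h₂]

theorem apply_mem_ideal {I : Ideal R} {B B' : Type*} (f : (B →₀ R) →ₗ[R] (B' →₀ R)) {x : B →₀ R}
    (hx : ∀ b, x b ∈ I) (b : B') : f x b ∈ I := by
  rw [← Finsupp.sum_single x, Finsupp.sum, map_sum, Finsupp.finsetSum_apply]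
  refine Submodule.sum_mem _ fun c _ => ?_
  rw [← mul_one (x c), ← smul_eq_mul, ← Finsupp.smul_single, map_smul, Finsupp.smul_apply,
    smul_eq_mul]
  exact I.mul_mem_right _ (hx c)

theorem Hom.mem_cycleLifts {P Q : GradedFreeResolution 𝒜 J} (f : Hom P Q) {I : Ideal R} {i k : ℕ}
    {x : P.B i →₀ R} (hx : x ∈ P.cycleLifts I i k) : f.f i x ∈ Q.cycleLifts I i k := by
  cases i with
  | zero =>
    rw [mem_cycleLifts_zero] at hx ⊢
    exact f.hom 0 k x hx
  | succ i =>
    rw [mem_cycleLifts_succ] at hx ⊢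
    refine ⟨f.hom _ k x hx.1, ?_⟩
    rw [f.comm]
    exact apply_mem_ideal _ hx.2

theorem Hom.mem_boundaryLifts {P Q : GradedFreeResolution 𝒜 J} (f : Hom P Q) {I : Ideal R} {i : ℕ}
    {x : P.B i →₀ R} (hx : x ∈ P.boundaryLifts I i) : f.f i x ∈ Q.boundaryLifts I i := by
  rw [GradedFreeResolution.mem_boundaryLifts] at hx ⊢
  obtain ⟨w, hw⟩ := hx
  refine ⟨f.f (i + 1) w, ?_⟩
  rw [f.comm, ← map_sub]
  exact apply_mem_ideal _ hw

/-- Comparison maps in both directions compose to a map homotopic to the identity. On a cycle modulo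
`I` the term `h' (d x)` has coordinates in `I`, so `x` and its image differ by a boundary modulo
`I`. -/
theorem classRank_le [GradedAlgebra 𝒜] (hJ : J.IsHomogeneous 𝒜)
    (P Q : GradedFreeResolution 𝒜 J) (I : Ideal R) (i k : ℕ) : classRank (P.cycleLifts I i k) (P.boundaryLifts I i) ≤
      classRank (Q.cycleLifts I i k) (Q.boundaryLifts I i) := by
  obtain ⟨f⟩ := nonempty_hom hJ P Q
  obtain ⟨g⟩ := nonempty_hom hJ Q P
  refine _root_.classRank_le ((g.f i).restrictScalars F)
    (fun x hx => ⟨f.f i x, f.mem_cycleLifts hx, ?_⟩) fun y _ hy => g.mem_boundaryLifts hy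
  rw [GradedFreeResolution.mem_boundaryLifts]
  cases i with
  | zero =>
    obtain ⟨h, hh⟩ := exists_homotopy_zero f g
    refine ⟨h x, fun b => ?_⟩
    rw [LinearMap.restrictScalars_apply, hh, sub_self]
    exact I.zero_mem
  | succ i =>
    obtain ⟨h, h', hh⟩ := exists_homotopy_succ f g i
    refine ⟨h x, ?_⟩
    rw [LinearMap.restrictScalars_apply, hh, add_sub_cancel_left]
    exact apply_mem_ideal _ (mem_cycleLifts_succ.mp hx).2

/-- The graded pieces of Tor do not depend on the resolution. -/
theorem torDim_eq_classRank [GradedAlgebra 𝒜] (hJ : J.IsHomogeneous 𝒜)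
    (P Q : GradedFreeResolution 𝒜 J) (I : Ideal R) (i k : ℕ) : P.torDim I i k =
      Cardinal.toNat (classRank (Q.cycleLifts I i k) (Q.boundaryLifts I i)) := by
  rw [torDim_eq]
  exact congrArg _ (le_antisymm (classRank_le hJ P Q I i k) (classRank_le hJ Q P I i k))

end GradedFreeResolution

/-! ### The Koszul complex of the variables of a polynomial ring -/

namespace Koszul

section Sign

variable {V : Type v} [Fintype V]

/-- The sign `(-1) ^ #{u ∈ A | u < v}`, for a fixed enumeration of `V`. -/
noncomputable def sign (v : V) (A : Finset V) : ℤ :=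
  (-1) ^ (A.filter fun u => Fintype.equivFin V u < Fintype.equivFin V v).card

theorem sign_mul_self (v : V) (A : Finset V) : sign v A * sign v A = 1 := by
  rw [sign, ← mul_pow, neg_one_mul, neg_neg, one_pow]

theorem sign_insert_self [DecidableEq V] (v : V) (A : Finset V) : sign v (insert v A) = sign v A := by
  rw [sign, sign, Finset.filter_insert, if_neg (lt_irrefl _)]

theorem sign_erase_self [DecidableEq V] (v : V) (A : Finset V) : sign v (A.erase v) = sign v A := by
  rw [← sign_insert_self v (A.erase v)]
  by_cases h : v ∈ A
  · rw [Finset.insert_erase h]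
  · rw [Finset.erase_eq_of_notMem h, sign_insert_self]

theorem sign_insert [DecidableEq V] {u v : V} {A : Finset V} (hu : u ∉ A) :
    sign v (insert u A) =
      (if Fintype.equivFin V u < Fintype.equivFin V v then -1 else 1) * sign v A := by
  rw [sign, sign, Finset.filter_insert]
  split_ifs
  · rw [Finset.card_insert_of_notMem fun h => hu (Finset.mem_filter.mp h).1, pow_succ']
  · rw [one_mul]

/-- Inserting two elements in the two possible orders gives opposite signs. -/
theorem sign_mul_sign_insert [DecidableEq V] {u v : V} (huv : u ≠ v) {A : Finset V}
    (hu : u ∉ A) (hv : v ∉ A) :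
    sign u A * sign v (insert u A) = -(sign v A * sign u (insert v A)) := by
  rw [sign_insert hu, sign_insert hv]
  rcases lt_or_gt_of_ne ((Fintype.equivFin V).injective.ne huv) with h | h
  · rw [if_pos h, if_neg h.not_gt]; ring
  · rw [if_pos h, if_neg h.not_gt]; ring

theorem sign_insert_mul_sign_insert [DecidableEq V] {u v : V} (huv : u ≠ v) {A : Finset V}
    (hu : u ∉ A) (hv : v ∉ A) :
    sign v (insert u A) * sign u (insert v A) = -(sign u A * sign v A) := by
  have h := sign_mul_sign_insert huv hu hv
  have h₁ := sign_mul_self u A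
  have h₂ := sign_mul_self u (insert v A)
  -- Multiply `h` by these two signs and cancel the resulting squares.
  linear_combination sign u A * sign u (insert v A) * h -
    sign v (insert u A) * sign u (insert v A) * h₁ - sign u A * sign v A * h₂

end Sign

/-! ### Monomial truncations and division by a variable -/

variable (F : Type u) (V : Type v) [Field F]

/-- The underlying module of the Koszul complex: the free module on the subsets of `V`. -/
abbrev KoszulModule := Finset V →₀ MvPolynomial V F

variable {F V}

theorem KoszulModule.hom_ext {f g : KoszulModule F V →ₗ[F] KoszulModule F V}
    (h : ∀ A a r, f (Finsupp.single A (MvPolynomial.monomial a r)) =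
      g (Finsupp.single A (MvPolynomial.monomial a r))) : f = g := by
  refine Finsupp.lhom_ext' fun A => (MvPolynomial.basisMonomials V F).ext fun a => ?_
  rw [MvPolynomial.coe_basisMonomials]
  exact h A a 1

/-- The projection to the span of the `x ^ a • e_A` for which `p A a` holds. -/
noncomputable def trunc (p : Finset V → (V →₀ ℕ) → Prop) :
    KoszulModule F V →ₗ[F] KoszulModule F V :=
  open Classical in
  Finsupp.lsum F fun A => (Finsupp.lsingle A).comp
    ((MvPolynomial.basisMonomials V F).constr F fun a =>
      if p A a then MvPolynomial.monomial a (1 : F) else 0)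

theorem monomial_eq_smul (a : V →₀ ℕ) (r : F) :
    MvPolynomial.monomial a r = r • MvPolynomial.basisMonomials V F a := by
  rw [MvPolynomial.coe_basisMonomials, MvPolynomial.smul_monomial, smul_eq_mul, mul_one]

open Classical in
theorem trunc_single_monomial (p : Finset V → (V →₀ ℕ) → Prop) (A : Finset V) (a : V →₀ ℕ)
    (r : F) : trunc p (Finsupp.single A (MvPolynomial.monomial a r)) =
      if p A a then Finsupp.single A (MvPolynomial.monomial a r) else 0 := by
  rw [trunc, Finsupp.lsum_single, LinearMap.comp_apply, monomial_eq_smul, map_smul,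
    Module.Basis.constr_basis]
  split_ifs
  · rw [Finsupp.lsingle_apply, MvPolynomial.coe_basisMonomials]
  · rw [smul_zero, map_zero]

/-- The coefficient of `x ^ a • e_A`. -/
noncomputable def coeff (A : Finset V) (a : V →₀ ℕ) : KoszulModule F V →ₗ[F] F :=
  (MvPolynomial.lcoeff F a).comp (Finsupp.lapply A)

theorem coeff_apply (A : Finset V) (a : V →₀ ℕ) (x : KoszulModule F V) :
    coeff A a x = MvPolynomial.coeff a (x A) := rfl

theorem KoszulModule.ext_coeff {x y : KoszulModule F V} (h : ∀ A a, coeff A a x = coeff A a y) :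
    x = y := by
  ext A a
  exact h A a

open Classical in
theorem coeff_trunc (p : Finset V → (V →₀ ℕ) → Prop) (A : Finset V) (a : V →₀ ℕ)
    (x : KoszulModule F V) : coeff A a (trunc p x) = if p A a then coeff A a x else 0 := by
  induction x using Finsupp.induction_linear with
  | zero => simp
  | add x y hx hy => rw [map_add, map_add, map_add, hx, hy]; split_ifs <;> simp
  | single B q =>
    induction q using MvPolynomial.induction_on' with
    | monomial b r =>
      rw [trunc_single_monomial]
      by_cases hA : B = A
      · subst hA
        by_cases ha : b = a
        · subst ha
          split_ifs <;> simp
        · split_ifs <;> simp [coeff_apply, MvPolynomial.coeff_monomial, ha]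
      · split_ifs <;> simp [coeff_apply, hA]
    | add q q' hq hq' =>
      rw [Finsupp.single_add, map_add, map_add, map_add, hq, hq']; split_ifs <;> simp

theorem trunc_trunc (p q : Finset V → (V →₀ ℕ) → Prop) (x : KoszulModule F V) :
    trunc p (trunc q x) = trunc (fun A a => p A a ∧ q A a) x := by
  classical
  refine KoszulModule.ext_coeff fun A a => ?_
  simp only [coeff_trunc]
  split_ifs <;> simp_all

theorem trunc_eq_self {p : Finset V → (V →₀ ℕ) → Prop} {x : KoszulModule F V}
    (h : ∀ A a, ¬ p A a → coeff A a x = 0) : trunc p x = x := by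
  classical
  refine KoszulModule.ext_coeff fun A a => ?_
  rw [coeff_trunc]
  split_ifs with hp
  exacts [rfl, (h A a hp).symm]

theorem sub_trunc (p : Finset V → (V →₀ ℕ) → Prop) (x : KoszulModule F V) :
    x - trunc p x = trunc (fun A a => ¬ p A a) x := by
  classical
  refine KoszulModule.ext_coeff fun A a => ?_
  rw [map_sub, coeff_trunc, coeff_trunc]
  split_ifs <;> simp

/-- Division by the variable `x_v` of the monomials whose degree in `x_v` exceeds `n`; the other
monomials are mapped to zero. -/
noncomputable def lower (n : ℕ) (v : V) : MvPolynomial V F →ₗ[F] MvPolynomial V F :=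
  (MvPolynomial.basisMonomials V F).constr F fun a =>
    if n < a v then MvPolynomial.monomial (a - Finsupp.single v 1) (1 : F) else 0

theorem lower_monomial (n : ℕ) (v : V) (a : V →₀ ℕ) (r : F) :
    lower n v (MvPolynomial.monomial a r) =
      if n < a v then MvPolynomial.monomial (a - Finsupp.single v 1) r else 0 := by
  rw [lower, monomial_eq_smul, map_smul, Module.Basis.constr_basis, smul_ite,
    MvPolynomial.smul_monomial, smul_eq_mul, mul_one, smul_zero]

theorem sub_single_add_single {a : V →₀ ℕ} {v : V} (h : 0 < a v) :
    a - Finsupp.single v 1 + Finsupp.single v 1 = a :=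
  tsub_add_cancel_of_le (Finsupp.single_le_iff.mpr h)

theorem coeff_lower (n : ℕ) (v : V) (p : MvPolynomial V F) (b : V →₀ ℕ) :
    MvPolynomial.coeff b (lower n v p) =
      if n ≤ b v then MvPolynomial.coeff (b + Finsupp.single v 1) p else 0 := by
  classical
  induction p using MvPolynomial.induction_on' with
  | monomial a r =>
    rw [lower_monomial, apply_ite (MvPolynomial.coeff b), MvPolynomial.coeff_monomial,
      MvPolynomial.coeff_monomial, MvPolynomial.coeff_zero]
    by_cases hab : a = b + Finsupp.single v 1
    · subst hab
      simp
    · rw [if_neg hab, ite_self]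
      split_ifs with h1 h2
      · exact absurd (by rw [← h2, sub_single_add_single (by omega)]) hab
      · rfl
      · rfl
  | add p q hp hq =>
    rw [map_add, MvPolynomial.coeff_add, hp, hq, MvPolynomial.coeff_add]
    split_ifs <;> simp

theorem lower_X_mul {u v : V} (huv : u ≠ v) (n : ℕ) (p : MvPolynomial V F) :
    lower n v (MvPolynomial.X u * p) = MvPolynomial.X u * lower n v p := by
  induction p using MvPolynomial.induction_on' with
  | monomial a r =>
    rw [lower_monomial, MvPolynomial.X, MvPolynomial.monomial_mul, lower_monomial, mul_ite,
      MvPolynomial.monomial_mul, mul_zero, Finsupp.add_apply, Finsupp.single_eq_of_ne' huv,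
      zero_add]
    split_ifs with h
    · rw [add_tsub_assoc_of_le (Finsupp.single_le_iff.mpr (by omega))]
    · rfl
  | add p q hp hq => rw [mul_add, map_add, map_add, hp, hq, mul_add]

theorem mapRange_lower_smul {u v : V} (huv : u ≠ v) (n : ℕ) (x : KoszulModule F V) :
    Finsupp.mapRange.linearMap (lower n v) ((MvPolynomial.X u : MvPolynomial V F) • x) =
      (MvPolynomial.X u : MvPolynomial V F) • Finsupp.mapRange.linearMap (lower n v) x := by
  ext1 A
  simp [lower_X_mul huv]

theorem X_mul_lower (n : ℕ) (v : V) (a : V →₀ ℕ) (r : F) :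
    MvPolynomial.X v * lower n v (MvPolynomial.monomial a r) =
      if n < a v then MvPolynomial.monomial a r else 0 := by
  rw [lower_monomial, mul_ite, mul_zero, MvPolynomial.X, MvPolynomial.monomial_mul, one_mul]
  split_ifs with h
  · rw [add_comm, sub_single_add_single (by omega)]
  · rfl

/-- Multiplying before lowering shifts the threshold by one compared with `X_mul_lower`. This shift
is the contribution of `v ∈ A` to the multidegree. -/
theorem lower_X_mul_self (n : ℕ) (v : V) (a : V →₀ ℕ) (r : F) :
    lower n v (MvPolynomial.X v * MvPolynomial.monomial a r) =
      if n < a v + 1 then MvPolynomial.monomial a r else 0 := by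
  rw [MvPolynomial.X, MvPolynomial.monomial_mul, one_mul, lower_monomial, Finsupp.add_apply,
    Finsupp.single_eq_same, add_comm 1, add_tsub_cancel_left]

/-- The exponent of `v` in the multidegree of `x ^ a • e_A`. -/
def mdeg [DecidableEq V] (A : Finset V) (a : V →₀ ℕ) (v : V) : ℕ :=
  a v + if v ∈ A then 1 else 0

/-! ### Contraction, exterior multiplication, the differential and its homotopies -/

variable [Fintype V] [DecidableEq V]

/-- Contraction with the dual of `e_v`. -/
noncomputable def contract (v : V) : KoszulModule F V →ₗ[MvPolynomial V F] KoszulModule F V :=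
  Finsupp.lsum (MvPolynomial V F) fun A =>
    if v ∈ A then sign v A • Finsupp.lsingle (A.erase v) else 0

/-- Exterior multiplication by `e_v`. -/
noncomputable def wedge (v : V) : KoszulModule F V →ₗ[MvPolynomial V F] KoszulModule F V :=
  Finsupp.lsum (MvPolynomial V F) fun A =>
    if v ∈ A then 0 else sign v A • Finsupp.lsingle (insert v A)

theorem contract_single (v : V) (A : Finset V) (p : MvPolynomial V F) :
    contract v (Finsupp.single A p) =
      if v ∈ A then sign v A • Finsupp.single (A.erase v) p else 0 := by
  rw [contract, Finsupp.lsum_single]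
  split_ifs <;> rfl

theorem wedge_single (v : V) (A : Finset V) (p : MvPolynomial V F) :
    wedge v (Finsupp.single A p) =
      if v ∈ A then 0 else sign v A • Finsupp.single (insert v A) p := by
  rw [wedge, Finsupp.lsum_single]
  split_ifs <;> rfl

theorem contract_wedge_self (v : V) (A : Finset V) (p : MvPolynomial V F) :
    contract v (wedge v (Finsupp.single A p)) = if v ∈ A then 0 else Finsupp.single A p := by
  rw [wedge_single]
  split_ifs with h
  · rw [map_zero]
  · rw [map_zsmul, contract_single, if_pos (Finset.mem_insert_self v A), sign_insert_self,
      smul_smul, sign_mul_self, one_smul, Finset.erase_insert h]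

theorem wedge_contract_self (v : V) (A : Finset V) (p : MvPolynomial V F) :
    wedge v (contract v (Finsupp.single A p)) = if v ∈ A then Finsupp.single A p else 0 := by
  rw [contract_single]
  split_ifs with h
  · rw [map_zsmul, wedge_single, if_neg (Finset.notMem_erase v A), sign_erase_self,
      smul_smul, sign_mul_self, one_smul, Finset.insert_erase h]
  · rw [map_zero]

theorem contract_apply (v : V) (x : KoszulModule F V) (A : Finset V) :
    contract v x A = if v ∈ A then 0 else sign v A • x (insert v A) := by
  induction x using Finsupp.induction_linear with
  | zero => simp
  | add x y hx hy => rw [map_add, Finsupp.add_apply, hx, hy]; split_ifs <;> simp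
  | single B p =>
    rw [contract_single]
    by_cases hB : v ∈ B
    · rw [if_pos hB]
      by_cases hA : v ∈ A
      · rw [if_pos hA, Finsupp.smul_apply, Finsupp.single_eq_of_ne, smul_zero]
        rintro rfl
        exact Finset.notMem_erase _ _ hA
      · rw [if_neg hA]
        by_cases h : B = insert v A
        · subst h
          simp [Finset.erase_insert hA, sign_insert_self]
        · rw [Finsupp.smul_apply, Finsupp.single_eq_of_ne, Finsupp.single_eq_of_ne, smul_zero,
            smul_zero]
          · exact fun h' => h h'.symm
          · rintro rfl
            exact h (Finset.insert_erase hB).symm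
    · rw [if_neg hB, Finsupp.zero_apply]
      split_ifs with hA
      · rfl
      · rw [Finsupp.single_eq_of_ne, smul_zero]
        rintro rfl
        exact hB (Finset.mem_insert_self _ _)

theorem contract_contract_self (v : V) (x : KoszulModule F V) :
    contract v (contract v x) = 0 := by
  ext1 A
  rw [contract_apply, contract_apply, if_pos (Finset.mem_insert_self v A), smul_zero, ite_self,
    Finsupp.zero_apply]

theorem contract_contract {u v : V} (huv : u ≠ v) (x : KoszulModule F V) :
    contract u (contract v x) + contract v (contract u x) = 0 := by
  ext1 A
  rw [Finsupp.add_apply, contract_apply, contract_apply, contract_apply, contract_apply]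
  by_cases hu : u ∈ A
  · rw [if_pos hu, if_pos (Finset.mem_insert_of_mem hu), smul_zero, ite_self, add_zero,
      Finsupp.zero_apply]
  by_cases hv : v ∈ A
  · rw [if_pos hv, if_pos (Finset.mem_insert_of_mem hv), smul_zero, ite_self, add_zero,
      Finsupp.zero_apply]
  rw [if_neg hu, if_neg hv, if_neg, if_neg, smul_smul, smul_smul, Finset.insert_comm v u,
    ← add_smul, sign_mul_sign_insert huv hu hv, neg_add_cancel, zero_smul, Finsupp.zero_apply]
  · simp [hu, huv]
  · simp [hv, huv.symm]

theorem contract_wedge {u v : V} (huv : u ≠ v) (x : KoszulModule F V) :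
    contract u (wedge v x) + wedge v (contract u x) = 0 := by
  induction x using Finsupp.induction_linear with
  | zero => simp
  | add x y hx hy =>
    simp only [map_add]
    rw [add_add_add_comm, hx, hy, add_zero]
  | single A p =>
    rw [wedge_single, contract_single]
    by_cases hu : u ∈ A
    · by_cases hv : v ∈ A
      · rw [if_pos hu, if_pos hv, map_zero, map_zsmul, wedge_single,
          if_pos (Finset.mem_erase_of_ne_of_mem huv.symm hv), smul_zero, add_zero]
      · obtain ⟨B, huB, rfl⟩ : ∃ B, u ∉ B ∧ insert u B = A :=
          ⟨A.erase u, Finset.notMem_erase u A, Finset.insert_erase hu⟩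
        have hvB : v ∉ B := fun h => hv (Finset.mem_insert_of_mem h)
        rw [if_pos hu, if_neg hv, map_zsmul, map_zsmul, wedge_single, contract_single,
          Finset.erase_insert huB, if_neg hvB, if_pos (Finset.mem_insert_of_mem hu),
          Finset.insert_comm, sign_insert_self, sign_insert_self,
          Finset.erase_insert (by simp [huB, huv]), smul_smul, smul_smul, ← add_smul,
          sign_insert_mul_sign_insert huv huB hvB, neg_add_cancel, zero_smul]
    · rw [if_neg hu, map_zero, add_zero]
      split_ifs with hv
      · rw [map_zero]
      · rw [map_zsmul, contract_single, if_neg (by simp [hu, huv]), smul_zero]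

/-- The Koszul differential. -/
noncomputable def diff : KoszulModule F V →ₗ[MvPolynomial V F] KoszulModule F V :=
  ∑ v, (MvPolynomial.X v : MvPolynomial V F) • contract v

theorem diff_apply (x : KoszulModule F V) :
    diff x = ∑ v, (MvPolynomial.X v : MvPolynomial V F) • contract v x := by
  rw [diff, LinearMap.sum_apply]
  rfl

theorem diff_diff (x : KoszulModule F V) : diff (diff x) = 0 := by
  rw [diff_apply]
  simp_rw [diff_apply x, map_sum, Finset.smul_sum, map_smul, smul_smul]
  rw [← Finset.sum_product']
  -- The terms for `(u, v)` and `(v, u)` cancel by anticommutation, and the diagonal terms vanish.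
  refine Finset.sum_involution (fun p _ => p.swap) ?_ ?_ (fun _ _ => Finset.mem_univ _)
    fun _ _ => Prod.swap_swap _
  · rintro ⟨a, b⟩ -
    by_cases hab : a = b
    · subst hab
      simp [contract_contract_self]
    · simp only [Prod.swap]
      rw [mul_comm, ← smul_add, contract_contract hab, smul_zero]
  · rintro ⟨a, b⟩ - h hab
    obtain rfl : b = a := congrArg Prod.fst hab
    exact h (by simp [contract_contract_self])

/-- The homotopy of the Koszul complex belonging to the vertex `v`. -/
noncomputable def homotopy (n : ℕ) (v : V) : KoszulModule F V →ₗ[F] KoszulModule F V :=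
  (Finsupp.mapRange.linearMap (lower n v)).comp ((wedge v).restrictScalars F)

theorem homotopy_apply (n : ℕ) (v : V) (x : KoszulModule F V) :
    homotopy n v x = Finsupp.mapRange.linearMap (lower n v) (wedge v x) := rfl

theorem diff_apply_apply (x : KoszulModule F V) (A : Finset V) :
    diff x A = ∑ v, if v ∈ A then 0 else
      sign v A • (MvPolynomial.X v * x (insert v A)) := by
  rw [diff_apply, Finsupp.finsetSum_apply]
  refine Finset.sum_congr rfl fun v _ => ?_
  rw [Finsupp.smul_apply, contract_apply, smul_eq_mul, mul_ite, mul_zero, mul_smul_comm]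

theorem mapRange_lower_contract (n : ℕ) (u v : V) (x : KoszulModule F V) :
    Finsupp.mapRange.linearMap (lower n v) (contract u x) =
      contract u (Finsupp.mapRange.linearMap (lower n v) x) := by
  ext1 A
  simp only [Finsupp.mapRange.linearMap_apply, Finsupp.mapRange_apply, contract_apply]
  split_ifs
  · rw [map_zero]
  · rw [map_zsmul]

/-- For `u ≠ v` the contributions cancel, as `contract u` anticommutes with `wedge v` and `X u`
commutes with `lower n v`. For `u = v` exactly one of the two composites survives, according to
whether `v ∈ A`, and both cases give the threshold `n < mdeg A a v`. -/
theorem diff_homotopy (n : ℕ) (v : V) (x : KoszulModule F V) :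
    diff (homotopy n v x) + homotopy n v (diff x) = trunc (fun A a => n < mdeg A a v) x := by
  refine LinearMap.congr_fun (f := (diff.restrictScalars F).comp (homotopy n v) +
    (homotopy n v).comp (diff.restrictScalars F)) (KoszulModule.hom_ext fun A a r => ?_) x
  rw [LinearMap.add_apply, LinearMap.comp_apply, LinearMap.comp_apply,
    LinearMap.restrictScalars_apply, LinearMap.restrictScalars_apply]
  set y : KoszulModule F V := Finsupp.single A (MvPolynomial.monomial a r) with hy
  rw [diff_apply y, map_sum, diff_apply, ← Finset.sum_add_distrib,
    Finset.sum_eq_single_of_mem v (Finset.mem_univ v)]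
  · rw [homotopy_apply, homotopy_apply, ← mapRange_lower_contract, map_smul, hy,
      contract_wedge_self, wedge_contract_self, trunc_single_monomial, mdeg]
    by_cases hv : v ∈ A
    · simp only [if_pos hv, map_zero, smul_zero, zero_add, Finsupp.smul_single, smul_eq_mul,
        Finsupp.mapRange.linearMap_apply, Finsupp.mapRange_single, lower_X_mul_self]
      split_ifs
      exacts [rfl, Finsupp.single_zero _]
    · simp only [if_neg hv, map_zero, smul_zero, add_zero, Finsupp.smul_single, smul_eq_mul,
        Finsupp.mapRange.linearMap_apply, Finsupp.mapRange_single, X_mul_lower]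
      split_ifs
      exacts [rfl, Finsupp.single_zero _]
  · intro u _ huv
    rw [homotopy_apply, homotopy_apply, map_smul, mapRange_lower_smul huv, ← smul_add,
      ← mapRange_lower_contract, ← map_add, contract_wedge huv, map_zero, smul_zero]

/-- The differential moves `x ^ a • e_A` to terms in which some `v ∈ A` has passed from `A` to the
exponent, so it suffices to compare the two conditions along such a move. -/
theorem trunc_diff {p q : Finset V → (V →₀ ℕ) → Prop}
    (hpq : ∀ A a, ∀ v ∈ A, (p (A.erase v) (a + Finsupp.single v 1) ↔ q A a))
    (x : KoszulModule F V) : trunc p (diff x) = diff (trunc q x) := by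
  suffices h : (trunc p).comp (diff.restrictScalars F) = (diff.restrictScalars F).comp (trunc q) by
    exact LinearMap.congr_fun h x
  refine KoszulModule.hom_ext fun A a r => ?_
  classical
  rw [LinearMap.comp_apply, LinearMap.comp_apply,
    LinearMap.restrictScalars_apply, LinearMap.restrictScalars_apply, trunc_single_monomial,
    apply_ite diff, map_zero, diff_apply, map_sum]
  have key : ∀ v, trunc p ((MvPolynomial.X v : MvPolynomial V F) •
      contract v (Finsupp.single A (MvPolynomial.monomial a r))) = if q A a then
        (MvPolynomial.X v : MvPolynomial V F) •
          contract v (Finsupp.single A (MvPolynomial.monomial a r)) else 0 := by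
    intro v
    rw [contract_single]
    by_cases hv : v ∈ A
    · rw [if_pos hv, smul_comm, Finsupp.smul_single, smul_eq_mul, MvPolynomial.X,
        MvPolynomial.monomial_mul, one_mul, map_zsmul, trunc_single_monomial, add_comm]
      simp only [hpq A a v hv]
      split_ifs
      · rfl
      · rw [smul_zero]
    · rw [if_neg hv, smul_zero, map_zero, ite_self]
  rw [Finset.sum_congr rfl fun v _ => key v]
  split_ifs <;> simp

theorem isHomogeneous_iff {F : Type u} {V : Type v} [Field F] {p : MvPolynomial V F} {n : ℕ} :
    p ∈ MvPolynomial.homogeneousSubmodule V F n ↔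
      ∀ a, MvPolynomial.coeff a p ≠ 0 → a.degree = n := by
  rw [MvPolynomial.mem_homogeneousSubmodule]
  refine forall_congr' fun a => imp_congr_right fun _ => ?_
  rw [Finsupp.degree_eq_weight_one]
  rfl

/-! ### Reduction of cycles modulo an ideal to bounded multidegree -/

section Truncation

variable {F : Type u} {V : Type v} [Field F] [Fintype V] [DecidableEq V]

theorem homotopy_mem {I : Ideal (MvPolynomial V F)} {n : ℕ} {v : V}
    (hI : ∀ p ∈ I, lower n v p ∈ I) {x : KoszulModule F V} (hx : ∀ A, x A ∈ I) (A : Finset V) :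
    homotopy n v x A ∈ I :=
  hI _ (GradedFreeResolution.apply_mem_ideal (wedge v) hx A)

/-- A cycle modulo `I` is homologous to its part of multidegree at most `n`, provided that
dividing by a variable the monomials of degree more than `n` in it preserves `I`. -/
theorem trunc_homologous {I : Ideal (MvPolynomial V F)} {n : ℕ}
    (hI : ∀ v, ∀ p ∈ I, lower n v p ∈ I) {x : KoszulModule F V} (hx : ∀ A, diff x A ∈ I)
    (U : Finset V) :
    (∀ A, diff (trunc (fun A a => ∀ v ∈ U, mdeg A a v ≤ n) x) A ∈ I) ∧
      ∃ w : KoszulModule F V, ∀ A : Finset V,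
        (x - trunc (fun A a => ∀ v ∈ U, mdeg A a v ≤ n) x - diff w) A ∈ I := by
  induction U using Finset.induction_on with
  | empty =>
    rw [trunc_eq_self fun A a h => absurd (by simp) h]
    refine ⟨hx, 0, fun A => ?_⟩
    rw [map_zero, sub_zero, sub_self]
    exact I.zero_mem
  | insert v U _ ih =>
    obtain ⟨hy, w, hw⟩ := ih
    set y := trunc (fun A a => ∀ v ∈ U, mdeg A a v ≤ n) x
    -- Truncating at one more vertex subtracts `dh + hd`. The part `dh` is a boundary, and `hd` has
    -- coordinates in `I` because `h` preserves the ideal.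
    have hstep : trunc (fun A a => ∀ u ∈ insert v U, mdeg A a u ≤ n) x =
        y - (diff (homotopy n v y) + homotopy n v (diff y)) := by
      rw [diff_homotopy, sub_trunc, trunc_trunc]
      simp only [not_lt, Finset.forall_mem_insert]
    rw [hstep]
    constructor
    · intro A
      rw [map_sub, map_add, diff_diff, zero_add]
      exact I.sub_mem (hy A)
        (GradedFreeResolution.apply_mem_ideal diff (homotopy_mem (hI v) hy) A)
    · refine ⟨w + homotopy n v y, fun A => ?_⟩
      rw [map_add, show x - (y - (diff (homotopy n v y) + homotopy n v (diff y))) -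
        (diff w + diff (homotopy n v y)) = x - y - diff w + homotopy n v (diff y) by abel]
      exact I.add_mem (hw A) (homotopy_mem (hI v) hy A)

/-- The cycles of the Koszul complex modulo `I` in homological degree `i` and degree `k`. -/
noncomputable def cycles (I : Ideal (MvPolynomial V F)) (i k : ℕ) :
    Submodule F (KoszulModule F V) where
  carrier := {x | (∀ A a, coeff A a x ≠ 0 → A.card = i ∧ a.degree + i = k) ∧ ∀ A, diff x A ∈ I}
  zero_mem' := ⟨fun A a h => absurd (map_zero _) h, fun A => by
    rw [map_zero]; exact I.zero_mem⟩
  add_mem' := fun {x y} hx hy => ⟨fun A a h => by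
    rw [map_add] at h
    by_cases hxa : coeff A a x = 0
    · rw [hxa, zero_add] at h
      exact hy.1 A a h
    · exact hx.1 A a hxa, fun A => by
    rw [map_add]; exact I.add_mem (hx.2 A) (hy.2 A)⟩
  smul_mem' := fun r x hx => ⟨fun A a h => hx.1 A a fun h0 => h (by rw [map_smul, h0, smul_zero]),
    fun A => by
    rw [diff.map_smul_of_tower]
    exact Submodule.smul_of_tower_mem I r (hx.2 A)⟩

/-- The boundaries of the Koszul complex modulo `I`. -/
noncomputable def boundaries (I : Ideal (MvPolynomial V F)) : Submodule F (KoszulModule F V) where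
  carrier := {x | ∃ w : KoszulModule F V, ∀ A : Finset V, (x - diff w) A ∈ I}
  zero_mem' := ⟨0, fun A => by rw [map_zero, sub_zero]; exact I.zero_mem⟩
  add_mem' := fun {x y} ⟨w, hw⟩ ⟨w', hw'⟩ => ⟨w + w', fun A => by
    rw [map_add, add_sub_add_comm]; exact I.add_mem (hw A) (hw' A)⟩
  smul_mem' := fun r x ⟨w, hw⟩ => ⟨r • w, fun A => by
    rw [diff.map_smul_of_tower, ← smul_sub]
    exact Submodule.smul_of_tower_mem I r (hw A)⟩

theorem mem_homogeneousSubmodule_of_mem_cycles {I : Ideal (MvPolynomial V F)} {i k : ℕ}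
    {x : KoszulModule F V} (hx : x ∈ cycles I i k) (A : Finset V) :
    x A ∈ MvPolynomial.homogeneousSubmodule V F (k - i) := by
  rw [isHomogeneous_iff]
  intro a ha
  have := (hx.1 A a ha).2
  omega

instance finite_cycles (I : Ideal (MvPolynomial V F)) (i k : ℕ) :
    Module.Finite F (cycles I i k) := by
  have : Module.Finite F (MvPolynomial.homogeneousSubmodule V F (k - i)) :=
    Module.Finite.iff_fg.mpr (MvPolynomial.homogeneousSubmodule_fg V F _)
  let f : cycles I i k →ₗ[F] Finset V → MvPolynomial.homogeneousSubmodule V F (k - i) :=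
    LinearMap.pi fun A => (((Finsupp.lapply A).comp (cycles I i k).subtype).codRestrict _
      fun x => mem_homogeneousSubmodule_of_mem_cycles x.2 A)
  refine Module.Finite.of_injective f fun x y hxy => Subtype.ext (Finsupp.ext fun A => ?_)
  exact congrArg Subtype.val (congrFun hxy A)

end Truncation

/-! ### The Koszul resolution -/

section Resolution

variable (F : Type u) (V : Type v) [Field F]

/-- The basis of the Koszul complex in homological degree `i`. -/
abbrev Basis (i : ℕ) : Type (max u v) := ULift.{u} {A : Finset V // A.card = i}

variable {F V}

theorem basis_injective (i : ℕ) : Function.Injective fun b : Basis.{u} V i => b.down.1 :=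
  Subtype.val_injective.comp ULift.down_injective

/-- The inclusion of the part of homological degree `i`. -/
noncomputable def incl (i : ℕ) :
    (Basis.{u} V i →₀ MvPolynomial V F) →ₗ[MvPolynomial V F] KoszulModule F V :=
  Finsupp.lmapDomain _ _ fun b => b.down.1

/-- The projection to the part of homological degree `i`. -/
noncomputable def proj (i : ℕ) :
    KoszulModule F V →ₗ[MvPolynomial V F] (Basis.{u} V i →₀ MvPolynomial V F) :=
  Finsupp.lcomapDomain _ (basis_injective i)

theorem proj_apply {i : ℕ} (x : KoszulModule F V) (b : Basis.{u} V i) :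
    proj i x b = x b.down.1 := rfl

theorem incl_apply {i : ℕ} (y : Basis.{u} V i →₀ MvPolynomial V F) (b : Basis.{u} V i) :
    incl i y b.down.1 = y b :=
  Finsupp.mapDomain_apply (basis_injective i) y b

theorem incl_apply_of_card_ne {i : ℕ} (y : Basis.{u} V i →₀ MvPolynomial V F) {A : Finset V}
    (hA : A.card ≠ i) : incl i y A = 0 :=
  Finsupp.mapDomain_of_notMem_range _ _ fun ⟨b, hb⟩ => hA (hb ▸ b.down.2)

theorem proj_incl {i : ℕ} (y : Basis.{u} V i →₀ MvPolynomial V F) : proj i (incl i y) = y :=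
  Finsupp.ext fun b => by rw [proj_apply, incl_apply]

theorem incl_proj {i : ℕ} (x : KoszulModule F V) :
    incl i (proj.{u} i x) = trunc (fun A _ => A.card = i) x := by
  classical
  refine KoszulModule.ext_coeff fun A a => ?_
  rw [coeff_trunc, coeff_apply, coeff_apply]
  split_ifs with hA
  · rw [incl_apply _ (⟨A, hA⟩ : Basis V i), proj_apply]
  · rw [incl_apply_of_card_ne _ hA, MvPolynomial.coeff_zero]

theorem incl_mem_iff {I : Ideal (MvPolynomial V F)} {i : ℕ}
    {y : Basis.{u} V i →₀ MvPolynomial V F} : (∀ A, incl i y A ∈ I) ↔ ∀ b, y b ∈ I := by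
  refine ⟨fun h b => incl_apply y b ▸ h b.down.1, fun h A => ?_⟩
  by_cases hA : A.card = i
  · exact (incl_apply y ⟨A, hA⟩).symm ▸ h ⟨A, hA⟩
  · rw [incl_apply_of_card_ne y hA]
    exact I.zero_mem

theorem trunc_incl {i : ℕ} (y : Basis.{u} V i →₀ MvPolynomial V F) :
    trunc (fun A _ => A.card = i) (incl i y) = incl i y := by
  rw [← incl_proj, proj_incl]

theorem mem_maxHomogeneousIdeal {p : MvPolynomial V F} :
    p ∈ maxHomogeneousIdeal F V ↔ MvPolynomial.coeff 0 p = 0 := by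
  rw [maxHomogeneousIdeal, ← Set.image_univ, MvPolynomial.mem_ideal_span_X_image]
  constructor
  · intro h
    by_contra h0
    obtain ⟨v, -, hv⟩ := h 0 (MvPolynomial.mem_support_iff.mpr h0)
    exact hv rfl
  · intro h a ha
    by_contra! h0
    obtain rfl : a = 0 := Finsupp.ext fun v => h0 v (Set.mem_univ v)
    exact MvPolynomial.mem_support_iff.mp ha h

/-- The augmentation of the Koszul complex. -/
noncomputable def augmentation : (Basis.{u} V 0 →₀ MvPolynomial V F)
    →ₗ[MvPolynomial V F] MvPolynomial V F ⧸ maxHomogeneousIdeal F V :=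
  (maxHomogeneousIdeal F V).mkQ.comp (Finsupp.lapply ⟨∅, Finset.card_empty⟩)

theorem augmentation_eq_zero_iff {y : Basis.{u} V 0 →₀ MvPolynomial V F} :
    augmentation y = 0 ↔ coeff ∅ 0 (incl 0 y) = 0 := by
  rw [augmentation, LinearMap.comp_apply, Submodule.mkQ_apply, Submodule.Quotient.mk_eq_zero,
    mem_maxHomogeneousIdeal, Finsupp.lapply_apply, ← incl_apply]
  rfl

theorem mem_freeDegree_iff {i k : ℕ} {y : Basis.{u} V i →₀ MvPolynomial V F} :
    y ∈ freeDegree (MvPolynomial.homogeneousSubmodule V F) (fun _ : Basis.{u} V i => i) k ↔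
      ∀ A a, coeff A a (incl i y) ≠ 0 → A.card = i ∧ a.degree + i = k := by
  constructor
  · intro hy A a ha
    rw [coeff_apply] at ha
    have hA : A.card = i := by
      by_contra hA
      rw [incl_apply_of_card_ne y hA] at ha
      exact ha (MvPolynomial.coeff_zero a)
    refine ⟨hA, ?_⟩
    rw [incl_apply y ⟨A, hA⟩] at ha
    obtain ⟨h1, h2⟩ := hy ⟨A, hA⟩
    rcases lt_or_ge k i with hk | hk
    · rw [h2 hk] at ha
      exact absurd (MvPolynomial.coeff_zero a) ha
    · have h3 := isHomogeneous_iff.mp (h1 hk) a ha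
      dsimp only at h3
      omega
  · intro h b
    refine ⟨fun (hk : i ≤ k) => isHomogeneous_iff.mpr fun a ha => ?_, fun (hk : k < i) => ?_⟩
    · rw [← incl_apply y b] at ha
      have := (h _ a ha).2
      dsimp only
      omega
    · ext a
      rw [MvPolynomial.coeff_zero]
      by_contra ha
      rw [← incl_apply y b] at ha
      have := (h _ a ha).2
      omega

variable [Fintype V] [DecidableEq V]

/-- The Koszul differential in homological degree `i + 1`. -/
noncomputable def differential (i : ℕ) : (Basis.{u} V (i + 1) →₀ MvPolynomial V F)
    →ₗ[MvPolynomial V F] (Basis.{u} V i →₀ MvPolynomial V F) :=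
  (proj i).comp (diff.comp (incl (i + 1)))

theorem trunc_card_diff (i : ℕ) (x : KoszulModule F V) :
    trunc (fun A _ => A.card = i) (diff x) = diff (trunc (fun A _ => A.card = i + 1) x) := by
  refine trunc_diff (fun A a v hv => ?_) x
  have := Finset.card_erase_add_one hv
  omega

theorem incl_differential {i : ℕ} (y : Basis.{u} V (i + 1) →₀ MvPolynomial V F) :
    incl i (differential i y) = diff (incl (i + 1) y) := by
  rw [differential, LinearMap.comp_apply, LinearMap.comp_apply, incl_proj, trunc_card_diff,
    trunc_incl]

theorem differential_proj {i : ℕ} (x : KoszulModule F V) :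
    differential i (proj (i + 1) x) = proj.{u} i (diff x) := by
  rw [differential, LinearMap.comp_apply, LinearMap.comp_apply, incl_proj, ← trunc_card_diff,
    ← incl_proj, proj_incl]

theorem diff_incl_zero (y : Basis.{u} V 0 →₀ MvPolynomial V F) : diff (incl 0 y) = 0 := by
  ext1 A
  rw [diff_apply_apply, Finsupp.zero_apply]
  refine Finset.sum_eq_zero fun v _ => ?_
  rw [incl_apply_of_card_ne y (Finset.card_ne_zero_of_mem (Finset.mem_insert_self v A)), mul_zero,
    smul_zero, ite_self]

/-- The Koszul complex is exact away from the constants. -/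
theorem mem_range_diff {x : KoszulModule F V} (hx : diff x = 0) (h0 : coeff ∅ 0 x = 0) :
    ∃ w, diff w = x := by
  -- With the zero ideal and threshold 0 only multidegree 0 survives, that is, the constant
  -- coefficient of `e_∅`, which vanishes by `h0`.
  obtain ⟨-, w, hw⟩ := trunc_homologous (I := ⊥) (n := 0) (x := x)
    (fun v p hp => by rw [Ideal.mem_bot] at hp ⊢; rw [hp, map_zero])
    (fun A => by rw [hx]; exact Ideal.zero_mem _) Finset.univ
  refine ⟨w, ?_⟩
  have hz : trunc (fun A a => ∀ v ∈ Finset.univ, mdeg A a v ≤ 0) x = 0 := by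
    classical
    refine KoszulModule.ext_coeff fun A a => ?_
    rw [coeff_trunc, map_zero]
    split_ifs with h
    · have hA : A = ∅ := Finset.eq_empty_of_forall_notMem fun v hv => by
        have := h v (Finset.mem_univ v)
        rw [mdeg, if_pos hv] at this
        omega
      have ha : a = 0 := Finsupp.ext fun v => by
        have := h v (Finset.mem_univ v)
        rw [mdeg] at this
        simp only [Finsupp.zero_apply]
        omega
      rw [hA, ha, h0]
    · rfl
  rw [hz, sub_zero] at hw
  refine (sub_eq_zero.mp (Finsupp.ext fun A => ?_)).symm
  exact hw A

theorem coeff_zero_diff (x : KoszulModule F V) (A : Finset V) : coeff A 0 (diff x) = 0 := by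
  rw [coeff_apply, diff_apply_apply, MvPolynomial.coeff_sum]
  refine Finset.sum_eq_zero fun v _ => ?_
  split_ifs
  · rw [MvPolynomial.coeff_zero]
  · rw [MvPolynomial.coeff_smul, MvPolynomial.coeff_X_mul', if_neg (by simp), smul_zero]

theorem exact_augmentation :
    Function.Exact (differential (F := F) (V := V) 0) augmentation := by
  intro y
  rw [augmentation_eq_zero_iff]
  constructor
  · intro h
    obtain ⟨w, hw⟩ := mem_range_diff (diff_incl_zero y) h
    exact ⟨proj 1 w, by rw [differential_proj, hw, proj_incl]⟩
  · rintro ⟨z, rfl⟩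
    rw [incl_differential, coeff_zero_diff]

theorem exact_differential (i : ℕ) :
    Function.Exact (differential (F := F) (V := V) (i + 1)) (differential i) := by
  intro y
  constructor
  · intro h
    obtain ⟨w, hw⟩ := mem_range_diff (x := incl (i + 1) y)
      (by rw [← incl_differential, h, map_zero])
      (by rw [coeff_apply, incl_apply_of_card_ne y (by simp), MvPolynomial.coeff_zero])
    exact ⟨proj (i + 2) w, by rw [differential_proj, hw, proj_incl]⟩
  · rintro ⟨z, rfl⟩
    rw [← proj_incl (differential i _), incl_differential, incl_differential, diff_diff, map_zero]

attribute [local instance] MvPolynomial.gradedAlgebra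

theorem differential_homogeneous (i k : ℕ) (y : Basis.{u} V (i + 1) →₀ MvPolynomial V F)
    (hy : y ∈ freeDegree (MvPolynomial.homogeneousSubmodule V F)
      (fun _ : Basis.{u} V (i + 1) => i + 1) k) :
    differential i y ∈ freeDegree (MvPolynomial.homogeneousSubmodule V F)
      (fun _ : Basis.{u} V i => i) k := by
  rw [mem_freeDegree_iff] at hy ⊢
  have htr : trunc (fun A a => A.card = i ∧ a.degree + i = k) (diff (incl (i + 1) y)) =
      diff (incl (i + 1) y) := by
    rw [trunc_diff (q := fun A a => A.card = i + 1 ∧ a.degree + (i + 1) = k), trunc_eq_self]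
    · exact fun A a h => by_contra fun h' => h (hy A a h')
    · intro A a v hv
      have := Finset.card_erase_add_one hv
      rw [map_add, Finsupp.degree_single]
      omega
  classical
  intro A a ha
  rw [incl_differential, ← htr, coeff_trunc] at ha
  by_contra h
  exact ha (if_neg h)

variable (F V)

/-- The Koszul complex as a graded free resolution of the residue field. -/
noncomputable abbrev resolution : GradedFreeResolution (MvPolynomial.homogeneousSubmodule V F)
    (maxHomogeneousIdeal F V) where
  B := Basis.{u} V
  deg := fun i _ => i
  d := differential
  ε := augmentation
  d_homogeneous := differential_homogeneous
  ε_homogeneous := fun _ x hx => ⟨x ⟨∅, Finset.card_empty⟩, (hx _).1 (Nat.zero_le _), rfl⟩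
  ε_surjective := fun q => by
    obtain ⟨r, rfl⟩ := Submodule.Quotient.mk_surjective _ q
    exact ⟨Finsupp.single ⟨∅, Finset.card_empty⟩ r,
      congrArg (Submodule.Quotient.mk (p := maxHomogeneousIdeal F V)) Finsupp.single_eq_same⟩
  exact_zero := exact_augmentation
  exact_succ := exact_differential

/-! ### Koszul homology computes graded Betti numbers -/

variable {F V}

theorem incl_mem_cycles_iff {I : Ideal (MvPolynomial V F)} {i k : ℕ}
    {y : (resolution F V).B i →₀ MvPolynomial V F} :
    incl i y ∈ cycles I i k ↔ y ∈ (resolution F V).cycleLifts I i k := by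
  cases i with
  | zero =>
    rw [GradedFreeResolution.mem_cycleLifts_zero]
    refine Iff.trans ⟨fun h => h.1, fun h => ⟨h, fun A => ?_⟩⟩ mem_freeDegree_iff.symm
    rw [diff_incl_zero]
    exact I.zero_mem
  | succ i =>
    rw [GradedFreeResolution.mem_cycleLifts_succ]
    refine and_congr mem_freeDegree_iff.symm ?_
    rw [← incl_differential]
    exact incl_mem_iff

theorem incl_mem_boundaries_iff {I : Ideal (MvPolynomial V F)} {i : ℕ}
    {y : (resolution F V).B i →₀ MvPolynomial V F} :
    incl i y ∈ boundaries I ↔ y ∈ (resolution F V).boundaryLifts I i := by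
  rw [GradedFreeResolution.mem_boundaryLifts]
  constructor
  · rintro ⟨w, hw⟩
    refine ⟨proj (i + 1) w, fun b => ?_⟩
    have := GradedFreeResolution.apply_mem_ideal (proj.{u} i) hw b
    rw [map_sub, proj_incl, ← differential_proj] at this
    exact this
  · rintro ⟨w, hw⟩
    refine ⟨incl (i + 1) w, ?_⟩
    rw [← incl_differential, ← map_sub]
    exact incl_mem_iff.mpr hw

theorem incl_proj_of_mem_cycles {I : Ideal (MvPolynomial V F)} {i k : ℕ} {x : KoszulModule F V}
    (hx : x ∈ cycles I i k) : incl i (proj.{u} i x) = x := by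
  rw [incl_proj]
  exact trunc_eq_self fun A a h => by_contra fun h' => h (hx.1 A a h').1

/-- Graded Betti numbers are the dimensions of Koszul homology. -/
theorem gradedBetti_eq (I : Ideal (MvPolynomial V F)) (i k : ℕ) :
    gradedBetti I i k = Cardinal.toNat (classRank (cycles I i k) (boundaries I)) := by
  rw [gradedBetti, GradedFreeResolution.torDim_eq_classRank
    (maxHomogeneousIdeal_isHomogeneous F V) _ (resolution F V)]
  refine congrArg _ (le_antisymm ?_ ?_)
  · let pr : KoszulModule F V →ₗ[F] ((resolution F V).B i →₀ MvPolynomial V F) :=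
      (proj i).restrictScalars F
    refine classRank_le pr (fun y hy => ⟨incl i y,
      incl_mem_cycles_iff.mpr hy, ?_⟩) fun x hx hx' => ?_
    · rw [LinearMap.restrictScalars_apply, proj_incl, sub_self]
      exact Submodule.zero_mem _
    · rw [← incl_proj_of_mem_cycles hx] at hx'
      exact incl_mem_boundaries_iff.mp hx'
  · let inc : ((resolution F V).B i →₀ MvPolynomial V F) →ₗ[F] KoszulModule F V :=
      (incl i).restrictScalars F
    refine classRank_le inc (fun x hx => ⟨proj i x, ?_, ?_⟩)
      fun y _ hy => incl_mem_boundaries_iff.mpr hy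
    · rw [← incl_proj_of_mem_cycles hx] at hx
      exact incl_mem_cycles_iff.mp hx
    · rw [LinearMap.restrictScalars_apply, incl_proj_of_mem_cycles hx, sub_self]
      exact Submodule.zero_mem _

end Resolution

end Koszul

/-! ### Stanley-Reisner rings -/

section StanleyReisner

variable {F : Type u} {V : Type v} [Field F]

/-- The ideal is monomial, and `x ^ a` is divisible by the product over a nonface exactly when its
support is a nonface, as `Δ` is closed under inclusion. -/
theorem mem_stanleyReisnerIdeal {Δ : SComplex V} {p : MvPolynomial V F} :
    p ∈ stanleyReisnerIdeal F Δ ↔ ∀ a, MvPolynomial.coeff a p ≠ 0 → a.support ∉ Δ := by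
  classical
  have hgen : {p : MvPolynomial V F | ∃ A : Finset V, A ∉ Δ ∧ p = ∏ v ∈ A, MvPolynomial.X v} =
      (fun s => MvPolynomial.monomial s (1 : F)) ''
        ((fun A : Finset V => ∑ v ∈ A, Finsupp.single v 1) '' {A | A ∉ Δ}) := by
    ext p
    simp only [Set.mem_ofPred_eq, Set.image_image, Set.mem_image]
    refine exists_congr fun A => and_congr_right fun _ => ?_
    rw [MvPolynomial.monomial_sum_one, eq_comm]
    rfl
  have hle : ∀ (A : Finset V) (a : V →₀ ℕ),
      ∑ v ∈ A, Finsupp.single v 1 ≤ a ↔ A ⊆ a.support := by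
    intro A a
    have happ : ∀ u, (∑ v ∈ A, Finsupp.single v 1 : V →₀ ℕ) u = if u ∈ A then 1 else 0 := by
      intro u
      rw [Finsupp.finsetSum_apply]
      simp [Finsupp.single_apply]
    rw [Finsupp.le_def]
    refine forall_congr' fun u => ?_
    rw [happ, Finsupp.mem_support_iff]
    split_ifs with hu
    · simp [hu, Nat.one_le_iff_ne_zero]
    · simp [hu]
  rw [stanleyReisnerIdeal, hgen, MvPolynomial.mem_ideal_span_monomial_image]
  refine forall_congr' fun a => ?_
  rw [MvPolynomial.mem_support_iff, Set.exists_mem_image]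
  refine imp_congr_right fun _ => ?_
  simp only [hle]
  exact ⟨fun ⟨A, hA, hAa⟩ h => hA (Δ.lower hAa h), fun h => ⟨_, h, subset_rfl⟩⟩

/-- The threshold 1 means that only exponents at least 2 are lowered, so supports do not change. -/
theorem lower_mem_stanleyReisnerIdeal {Δ : SComplex V} {p : MvPolynomial V F}
    (hp : p ∈ stanleyReisnerIdeal F Δ) (v : V) : Koszul.lower 1 v p ∈ stanleyReisnerIdeal F Δ := by
  classical
  rw [mem_stanleyReisnerIdeal] at hp ⊢
  intro a ha
  rw [Koszul.coeff_lower] at ha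
  split_ifs at ha with hv
  · have := hp _ ha
    convert this using 2
    ext u
    by_cases huv : v = u
    · subst huv
      simp
      omega
    · simp [huv]
  · exact absurd rfl ha

theorem card_support_of_le_one {a : V →₀ ℕ} (ha : ∀ v, a v ≤ 1) : a.support.card = a.degree := by
  rw [Finset.card_eq_sum_ones, Finsupp.degree_apply]
  refine Finset.sum_congr rfl fun v hv => ?_
  have := Finsupp.mem_support_iff.mp hv
  have := ha v
  omega

/-! ### Comparison of two complexes in one bidegree -/

variable [Fintype V] [DecidableEq V]

-- The comparison map is truncation to squarefree multidegree and the given bidegree. The condition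
-- `h₂` turns squarefree cycles for `Δ` into cycles for `Δ'`, and `h₁` turns boundaries for `Δ'`
-- into boundaries for `Δ`.
open Koszul in
theorem classRank_stanleyReisner_le {Δ Δ' : SComplex V} {j : ℕ}
    (h₁ : ∀ A ∈ Δ, A.card = j → A ∈ Δ') (h₂ : ∀ A ∈ Δ', A.card ≤ j) (i : ℕ) :
    classRank (cycles (stanleyReisnerIdeal F Δ) i (i + j))
        (boundaries (stanleyReisnerIdeal F Δ)) ≤
      classRank (cycles (stanleyReisnerIdeal F Δ') i (i + j))
        (boundaries (stanleyReisnerIdeal F Δ')) := by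
  classical
  let sqf : Finset V → (V →₀ ℕ) → Prop := fun A a => ∀ v ∈ Finset.univ, mdeg A a v ≤ 1
  have hsqf : ∀ A a, ∀ v ∈ A, (sqf (A.erase v) (a + Finsupp.single v 1) ↔ sqf A a) := by
    intro A a v hv
    refine forall_congr' fun u => forall_congr' fun _ => ?_
    rw [mdeg, mdeg, Finsupp.add_apply]
    by_cases huv : u = v
    · subst huv
      simp [hv]
    · simp [huv]
  have hle : ∀ {A a}, sqf A a → ∀ v, a v ≤ 1 := fun h v =>
    (Nat.le_add_right _ _).trans (h v (Finset.mem_univ v))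
  let q : (ℕ → ℕ → Prop) → Finset V → (V →₀ ℕ) → Prop := fun s A a => sqf A a ∧ s A.card a.degree
  have hq : ∀ {s s' : ℕ → ℕ → Prop}, (∀ m n, s m (n + 1) ↔ s' (m + 1) n) → ∀ x : KoszulModule F V,
      trunc (q s) (diff x) = diff (trunc (q s') x) := by
    refine fun hs x => trunc_diff (fun A a v hv => and_congr (hsqf A a v hv) ?_) x
    rw [map_add, Finsupp.degree_single, hs, Finset.card_erase_add_one hv]
  let t : ℕ → ℕ → Prop := fun m n => m = i ∧ n = j
  refine classRank_le (trunc (q t)) (fun x hx => ?_) fun y hy hy' => ?_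
  · obtain ⟨hy, w, hw⟩ := trunc_homologous (n := 1)
      (fun v p hp => lower_mem_stanleyReisnerIdeal hp v) hx.2 Finset.univ
    change ∀ A, diff (trunc sqf x) A ∈ _ at hy
    change ∀ A, (x - trunc sqf x - diff w) A ∈ _ at hw
    have hself : trunc (q t) (trunc sqf x) = trunc sqf x := by
      refine trunc_eq_self fun A a h => by_contra fun h' => h ?_
      rw [coeff_trunc] at h'
      split_ifs at h' with h''
      · obtain ⟨h3, h4⟩ := hx.1 A a h'
        exact ⟨h'', h3, by omega⟩
      · exact absurd rfl h'
    refine ⟨trunc sqf x, ⟨fun A a h => hx.1 A a fun h0 => h ?_, fun A => ?_⟩, ?_⟩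
    · rw [coeff_trunc, h0, ite_self]
    · rw [mem_stanleyReisnerIdeal]
      intro a ha hmem
      rw [← coeff_apply] at ha
      -- The differential lands in squarefree exponents of degree `j + 1`, whose supports are too
      -- large to be faces of `Δ'`. Writing `m + 1 = i` covers `i = 0` without subtraction.
      rw [← hself, ← hq (s := fun m n => m + 1 = i ∧ n = j + 1) (fun m n => by omega),
        coeff_trunc] at ha
      split_ifs at ha with h
      · have := h₂ _ hmem
        rw [card_support_of_le_one (hle h.1), h.2.2] at this
        omega
      · exact ha rfl
    · rw [hself]
      exact ⟨w, hw⟩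
  · obtain ⟨w, hw⟩ := hy'
    -- Only this part of `w` has its differential in the bidegree of `y`; for `j = 0` it is zero.
    refine ⟨trunc (q fun m n => m = i + 1 ∧ n + 1 = j) w, fun A => ?_⟩
    rw [← hq (s := t) (s' := fun m n => m = i + 1 ∧ n + 1 = j)
      (fun m n => by dsimp only [t]; omega), ← map_sub, mem_stanleyReisnerIdeal]
    intro a ha hmem
    rw [← coeff_apply, coeff_trunc] at ha
    split_ifs at ha with h
    · refine mem_stanleyReisnerIdeal.mp (hw A) a ha (h₁ _ hmem ?_)
      rw [card_support_of_le_one (hle h.1), h.2.2]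
    · exact ha rfl

end StanleyReisner

theorem mainTheorem5 {F : Type u} [Field F] {V : Type v} [Fintype V] [DecidableEq V] {d : ℕ}
    (c : V → Fin d) (Δ : SComplex V) (hΔ : Δ.IsBalanced c) (i j : ℕ) :
    gradedBetti (stanleyReisnerIdeal F Δ) i (i + j) ≤
      gradedBetti (stanleyReisnerIdeal F
        (SComplex.skel ((j : ℤ) - 1)
          (SComplex.cliqueComplex (completePartiteGraph c)))) i (i + j) := by
  rw [Koszul.gradedBetti_eq, Koszul.gradedBetti_eq]
  refine Cardinal.toNat_le_toNat (classRank_stanleyReisner_le ?_ ?_ i) (classRank_lt_aleph0 _ _)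
  · refine fun A hA hAj => ⟨fun u hu v hv huv hc => ?_, ?_⟩
    · have h := hΔ.card_le_one A hA (c u)
      rw [Finset.card_le_one] at h
      exact huv (h u (Finset.mem_filter.mpr ⟨hu, rfl⟩) v (Finset.mem_filter.mpr ⟨hv, hc.symm⟩))
    · rw [SComplex.faceDim, hAj]
  · intro A hA
    have := hA.2
    rw [SComplex.faceDim] at this
    omega
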